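/- **Theorem (Classification of monoidal abelian groupoids).** *Setting.* A *monoidal abelian groupoid* is a monoidal category $\mathcal G$ in which every morphism is invertible and every group $\mathrm{Aut}_{\mathcal G}(X)$ is abelian. Monoidal functors $(F,\varphi,\varphi_0)$ have invertible structure constraints; an isomorphism of monoidal functors is a monoidal natural isomorphism; a monoidal functor $F:\mathcal G\to\mathcal G'$ is a (monoidal) *equivalence* if there are a monoidal functor $F':\mathcal G'\to\mathcal G$ and isomorphisms of monoidal functors $1\cong F'F$, $FF'\cong 1$. $\mathbf{MonAbGpd}$ is the category of monoidal abelian groupoids and monoidal functors. For a monoid $M$, let $\mathbb DM$ be the category with object set $M$ and arrows $(a,b,c):b\to abc$, with $(d,abc,e)(a,b,c)=(da,b,ce)$. A $\mathbb DM$-module $(\mathbb A,\Theta)$ is a functor from $\mathbb DM$ to abelian groups; we write $A_a$ for its values, $a_*:A_b\to A_{ab}$ and $b^*:A_a\to A_{ab}$ for the maps given by $(a,b,1)$ and $(1,a,b)$. The *Leech cohomology groups* $\mathrm H^n(M,(\mathbb A,\Theta))$, $n=2,3$, are those of the complex of normalized cochains $C^n=\{\lambda\in\prod_{(a_1,\dots,a_n)\in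 M^n}A_{a_1\cdots a_n}\mid \lambda_{a_1,\dots,a_n}=0 \text{ if some } a_i=1\}$ with $$(\partial^n\lambda)_{a_1,\dots,a_{n+1}}=(a_1)_*\lambda_{a_2,\dots,a_{n+1}}+\sum_{i=1}^n(-1)^i\lambda_{a_1,\dots,a_ia_{i+1},\dots,a_{n+1}}+(-1)^{n+1}a_{n+1}^*\lambda_{a_1,\dots,a_n}.$$ For a homomorphism $p:M\to M'$ and a $\mathbb DM'$-module $(\mathbb A',\Theta')$, $p^*(\mathbb A',\Theta')$ is the $\mathbb DM$-module obtained by composition with $\mathbb Dp$, and $p^*:\mathrm H^n(M',(\mathbb A',\Theta'))\to \mathrm H^n(M,p^*(\mathbb A',\Theta'))$ is $(p^*\lambda')_{a_1,\dots,a_n}=\lambda'_{p(a_1),\dots,p(a_n)}$ on cocycles; a morphism $\mathbb q=(q_a)$ of $\mathbb DM$-modules induces $\mathbb q_*$ by $(\mathbb q_*\lambda)_{a_1,\dots,a_n}=q_{a_1\cdots a_n}(\lambda_{a_1,\dots,a_n})$. $\mathbf{H^3Mnd}$ is the category whose objects are the triples $(M,(\mathbb A,\Theta),c)$ of a monoid,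 a $\mathbb DM$-module and a class $c\in\mathrm H^3(M,(\mathbb A,\Theta))$; an arrow $(M,(\mathbb A,\Theta),c)\to(M',(\mathbb A',\Theta'),c')$ is a pair $(p,\mathbb q)$ of a monoid homomorphism $p:M\to M'$ and a morphism of $\mathbb DM$-modules $\mathbb q:(\mathbb A,\Theta)\to p^*(\mathbb A',\Theta')$ with $p^*(c')=\mathbb q_*(c)$; composition is $(p',\mathbb q')(p,\mathbb q)=(p'p,(q'_{p(a)}q_a)_a)$. *The classifying functor.* For a monoidal abelian groupoid $\mathcal G$ let $M(\mathcal G)$ be the monoid of isomorphism classes of objects, $[X][Y]=[X\otimes Y]$. Choose a cleavage of each $\mathcal G$: objects $X_a\in a$ for $a\in M(\mathcal G)$, with $X_1=\mathrm I$; isomorphisms $\Gamma_X:X\to X_a$ for $X\in a$, with $\Gamma_{X_a}=1$; and isomorphisms $\Gamma_{a,b}:X_a\otimes X_b\to X_{ab}$ with $\Gamma_{1,a}$ and $\Gamma_{a,1}$ the left and right unit constraints of $X_a$. Let $A_a=\mathrm{Aut}(X_a)$, let $a_*(f)=\Gamma_{a,b}(1\otimes f)\Gamma_{a,b}^{-1}$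 for $f\in A_b$ and $b^*(g)=\Gamma_{a,b}(g\otimes 1)\Gamma_{a,b}^{-1}$ for $g\in A_a$, and let $\lambda_{a,b,c}\in\mathrm{Aut}(X_{abc})$ be determined by $\lambda_{a,b,c}\,\Gamma_{ab,c}(\Gamma_{a,b}\otimes 1)=\Gamma_{a,bc}(1\otimes\Gamma_{b,c})\,\boldsymbol a$, where $\boldsymbol a$ is the associativity constraint. This gives a $\mathbb DM(\mathcal G)$-module $(\mathbb A(\mathcal G),\Theta(\mathcal G))$ and a normalized 3-cocycle $\lambda(\mathcal G)$, and $$\mathrm{Cl}(\mathcal G)=\big(M(\mathcal G),(\mathbb A(\mathcal G),\Theta(\mathcal G)),[\lambda(\mathcal G)]\big).$$ For a monoidal functor $F:\mathcal G\to\mathcal G'$, $\mathrm{Cl}(F)=(p,\mathbb q)$ with $p([X])=[FX]$ and $q_a(f)=\Gamma'_{FX_a}\,F(f)\,(\Gamma'_{FX_a})^{-1}$ for $f\in\mathrm{Aut}(X_a)$. This defines a functor $\mathrm{Cl}:\mathbf{MonAbGpd}\to\mathbf{H^3Mnd}$. *Claim.* For every choice of cleavages, the following hold. (i) For any monoid $M$,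 any $\mathbb DM$-module $(\mathbb A,\Theta)$ and any class $c\in\mathrm H^3(M,(\mathbb A,\Theta))$, there is a monoidal abelian groupoid $\mathcal G$ with an isomorphism $\mathrm{Cl}(\mathcal G)\cong(M,(\mathbb A,\Theta),c)$ in $\mathbf{H^3Mnd}$. (ii) A monoidal functor $F:\mathcal G\to\mathcal G'$ between monoidal abelian groupoids is an equivalence if and only if $\mathrm{Cl}(F):\mathrm{Cl}(\mathcal G)\to\mathrm{Cl}(\mathcal G')$ is an isomorphism. (iii) For any isomorphism $(p,\mathbb q):\mathrm{Cl}(\mathcal G)\cong\mathrm{Cl}(\mathcal G')$ there is a monoidal equivalence $F:\mathcal G\to\mathcal G'$ with $\mathrm{Cl}(F)=(p,\mathbb q)$. (iv) Let $\mathrm{Cl}(\mathcal G)=(M,(\mathbb A,\Theta),c)$ and $\mathrm{Cl}(\mathcal G')=(M',(\mathbb A',\Theta'),c')$. For any morphism $(p,\mathbb q):\mathrm{Cl}(\mathcal G)\to\mathrm{Cl}(\mathcal G')$ in $\mathbf{H^3Mnd}$ there is a (non-natural) bijection $$\{[F]:\mathcal G\to\mathcal G'\mid \mathrm{Cl}(F)=(p,\mathbb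 q)\}\;\cong\;\mathrm H^2(M,p^*(\mathbb A',\Theta'))$$ between the set of isomorphism classes of the monoidal functors $F:\mathcal G\to\mathcal G'$ with $\mathrm{Cl}(F)=(p,\mathbb q)$ and the second Leech cohomology group of $M$ with coefficients in $p^*(\mathbb A',\Theta')$. -/

import Mathlib

open CategoryTheory MonoidalCategory

universe u v u' v' w

set_option linter.checkUnivs false

noncomputable section

namespace Leech

/-! ### The category `𝔻M` of a monoid and its modules -/

/-- Objects of the category `𝔻M`: the elements of the monoid `M`. -/
structure DCat (M : Type u) : Type u where
  /-- the underlying element -/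
  elt : M

/-- An arrow `(l, x, r) : x ⟶ l x r` of `𝔻M`. -/
@[ext]
structure DCat.Hom {M : Type u} [Monoid M] (x y : DCat M) : Type u where
  /-- left factor -/
  l : M
  /-- right factor -/
  r : M
  eq : l * x.elt * r = y.elt

instance {M : Type u} [Monoid M] : Category.{u} (DCat M) where
  Hom x y := DCat.Hom x y
  id x := ⟨1, 1, by simp⟩
  comp f g := ⟨g.l * f.l, f.r * g.r, by rw [← g.eq, ← f.eq]; simp only [mul_assoc]⟩
  id_comp f := by apply DCat.Hom.ext <;> simp
  comp_id f := by apply DCat.Hom.ext <;> simp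
  assoc f g h := by apply DCat.Hom.ext <;> simp [mul_assoc]

/-- The functor `𝔻p : 𝔻M ⥤ 𝔻M'` induced by a monoid homomorphism `p`. -/
def dFunctor {M : Type u} {M' : Type u'} [Monoid M] [Monoid M'] (p : M →* M') :
    DCat M ⥤ DCat M' where
  obj x := ⟨p x.elt⟩
  map f := ⟨p f.l, p f.r, by rw [← f.eq]; simp⟩
  map_id x := DCat.Hom.ext (map_one p) (map_one p)
  map_comp f g := DCat.Hom.ext (map_mul p _ _) (map_mul p _ _)

/-- `𝔻M`-modules: functors from `𝔻M` to abelian groups. -/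
abbrev DMod (M : Type u) [Monoid M] := DCat M ⥤ AddCommGrpCat.{v}

namespace DMod

variable {M : Type u} {M' : Type u'} {M'' : Type w} [Monoid M] [Monoid M'] [Monoid M'']

/-- The abelian group `A_a`. -/
abbrev at' (A : DMod.{u, v} M) (a : M) : Type v := A.obj ⟨a⟩

/-- The homomorphism `A_x ⟶ A_y` given by the arrow `(l, x, r)` of `𝔻M`, where `y = l x r`. -/
def act (A : DMod.{u, v} M) (l r : M) {x y : M} (h : l * x * r = y) : A.at' x →+ A.at' y :=
  (A.map (X := ⟨x⟩) (Y := ⟨y⟩) ⟨l, r, h⟩).hom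

/-- `a_* : A_x ⟶ A_y` where `y = a x`. -/
def lstar (A : DMod.{u, v} M) (a : M) {x y : M} (h : a * x = y) : A.at' x →+ A.at' y :=
  A.act a 1 (by rw [mul_one, h])

/-- `b^* : A_x ⟶ A_y` where `y = x b`. -/
def rstar (A : DMod.{u, v} M) (b : M) {x y : M} (h : x * b = y) : A.at' x →+ A.at' y :=
  A.act 1 b (by rw [one_mul, h])

/-- The identification `A_x = A_y` for `x = y` (the action of the identity arrow). -/
def tr (A : DMod.{u, v} M) {x y : M} (h : x = y) : A.at' x →+ A.at' y :=
  A.act 1 1 (by rw [one_mul, mul_one, h])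

lemma act_act (A : DMod.{u, v} M) {l r l' r' x y z : M} (h : l * x * r = y)
    (h' : l' * y * r' = z) (f : A.at' x) :
    A.act l' r' h' (A.act l r h f) =
      A.act (l' * l) (r * r') (by rw [← h', ← h]; simp only [mul_assoc]) f := by
  have := A.map_comp (X := ⟨x⟩) (Y := ⟨y⟩) (Z := ⟨z⟩) ⟨l, r, h⟩ ⟨l', r', h'⟩
  exact (congrArg (fun k => k.hom f) this).symm

lemma act_one (A : DMod.{u, v} M) {x : M} (h : 1 * x * 1 = x) (f : A.at' x) :
    A.act 1 1 h f = f :=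
  congrArg (fun k => k.hom f) (A.map_id ⟨x⟩)

lemma tr_rfl (A : DMod.{u, v} M) {x : M} (h : x = x) (f : A.at' x) : A.tr h f = f :=
  A.act_one _ f

/-- The `𝔻M`-module `p^* A'`. -/
abbrev pull (p : M →* M') (A' : DMod.{u', v} M') : DMod.{u, v} M := dFunctor p ⋙ A'

/-- The component `q_a : A_a ⟶ B_a` of a morphism of `𝔻M`-modules. -/
def comp' {A B : DMod.{u, v} M} (q : A ⟶ B) (a : M) : A.at' a →+ B.at' a := (q.app ⟨a⟩).hom

lemma comp'_act {A B : DMod.{u, v} M} (q : A ⟶ B) {l r x y : M} (h : l * x * r = y)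
    (f : A.at' x) : comp' q y (A.act l r h f) = B.act l r h (comp' q x f) := by
  have := q.naturality (X := ⟨x⟩) (Y := ⟨y⟩) ⟨l, r, h⟩
  exact congrArg (fun k => k.hom f) this

lemma pull_act (p : M →* M') (A' : DMod.{u', v} M') {l r x y : M} (h : l * x * r = y)
    (f : A'.at' (p x)) :
    (pull p A').act l r h f = A'.act (p l) (p r) (by rw [← h]; simp) f := rfl

lemma pull_lstar (p : M →* M') (A' : DMod.{u', v} M') {l x y : M} (h : l * x = y)
    (h' : p l * p x = p y) (f : A'.at' (p x)) :
    (pull p A').lstar l h f = A'.lstar (p l) h' f := by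
  change A'.act (p l) (p 1) _ f = A'.act (p l) 1 _ f
  simp only [map_one]

lemma pull_rstar (p : M →* M') (A' : DMod.{u', v} M') {r x y : M} (h : x * r = y)
    (h' : p x * p r = p y) (f : A'.at' (p x)) :
    (pull p A').rstar r h f = A'.rstar (p r) h' f := by
  change A'.act (p 1) (p r) _ f = A'.act 1 (p r) _ f
  simp only [map_one]

/-! ### The normalized cochain complex in degrees 1 to 4, and the groups `H²`, `H³`

Cochains are first written without normalization; the subgroups `C1`, `C2`, `C3` consist of the
normalized ones. -/

/-- Families `(δ_a ∈ A_a)`. -/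
abbrev Fam1 (A : DMod.{u, v} M) := ∀ a : M, A.at' a
/-- Families `(φ_{a,b} ∈ A_{ab})`. -/
abbrev Fam2 (A : DMod.{u, v} M) := ∀ a b : M, A.at' (a * b)
/-- Families `(λ_{a,b,c} ∈ A_{abc})`. -/
abbrev Fam3 (A : DMod.{u, v} M) := ∀ a b c : M, A.at' (a * b * c)
/-- Families indexed by quadruples, with values in `A_{abcd}`. -/
abbrev Fam4 (A : DMod.{u, v} M) := ∀ a b c d : M, A.at' (a * b * c * d)

/-- Normalized 1-cochains. -/
def C1 (A : DMod.{u, v} M) : AddSubgroup A.Fam1 where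
  carrier := {δ | δ 1 = 0}
  zero_mem' := rfl
  add_mem' {x y} hx hy := by
    have hx : x 1 = 0 := hx
    have hy : y 1 = 0 := hy
    simp [hx, hy]
  neg_mem' {x} hx := by
    have hx : x 1 = 0 := hx
    simp [hx]

/-- Normalized 2-cochains. -/
def C2 (A : DMod.{u, v} M) : AddSubgroup A.Fam2 where
  carrier := {φ | ∀ a, φ 1 a = 0 ∧ φ a 1 = 0}
  zero_mem' := fun _ => ⟨rfl, rfl⟩
  add_mem' hx hy a := by simp [(hx a).1, (hx a).2, (hy a).1, (hy a).2]
  neg_mem' hx a := by simp [(hx a).1, (hx a).2]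

/-- Normalized 3-cochains. -/
def C3 (A : DMod.{u, v} M) : AddSubgroup A.Fam3 where
  carrier := {μ | ∀ a b, μ 1 a b = 0 ∧ μ a 1 b = 0 ∧ μ a b 1 = 0}
  zero_mem' := fun _ _ => ⟨rfl, rfl, rfl⟩
  add_mem' hx hy a b := by
    simp [(hx a b).1, (hx a b).2.1, (hx a b).2.2, (hy a b).1, (hy a b).2.1, (hy a b).2.2]
  neg_mem' hx a b := by simp [(hx a b).1, (hx a b).2.1, (hx a b).2.2]

/-- The coboundary `∂¹`. -/
def d1 (A : DMod.{u, v} M) : A.Fam1 →+ A.Fam2 :=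
  AddMonoidHom.mk' (fun δ a b => A.lstar a rfl (δ b) - δ (a * b) + A.rstar b rfl (δ a)) (by
    intro x y
    funext a b
    simp only [Pi.add_apply, map_add]
    abel)

/-- The coboundary `∂²`. -/
def d2 (A : DMod.{u, v} M) : A.Fam2 →+ A.Fam3 :=
  AddMonoidHom.mk' (fun φ a b c =>
    A.lstar a (mul_assoc a b c).symm (φ b c) - φ (a * b) c
      + A.tr (mul_assoc a b c).symm (φ a (b * c)) - A.rstar c rfl (φ a b)) (by
    intro x y
    funext a b c
    simp only [Pi.add_apply, map_add]
    abel)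

/-- The coboundary `∂³`. -/
def d3 (A : DMod.{u, v} M) : A.Fam3 →+ A.Fam4 :=
  AddMonoidHom.mk' (fun μ a b c d =>
    A.lstar a (by simp only [mul_assoc]) (μ b c d) - μ (a * b) c d
      + A.tr (by simp only [mul_assoc]) (μ a (b * c) d)
      - A.tr (by simp only [mul_assoc]) (μ a b (c * d)) + A.rstar d rfl (μ a b c)) (by
    intro x y
    funext a b c d
    simp only [Pi.add_apply, map_add]
    abel)

/-- Normalized 2-cocycles. -/
def Z2 (A : DMod.{u, v} M) : AddSubgroup A.Fam2 := A.C2 ⊓ A.d2.ker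
/-- 2-coboundaries. -/
def B2 (A : DMod.{u, v} M) : AddSubgroup A.Fam2 := A.C1.map A.d1
/-- Normalized 3-cocycles. -/
def Z3 (A : DMod.{u, v} M) : AddSubgroup A.Fam3 := A.C3 ⊓ A.d3.ker
/-- 3-coboundaries. -/
def B3 (A : DMod.{u, v} M) : AddSubgroup A.Fam3 := A.C2.map A.d2

lemma B2_le_Z2 (A : DMod.{u, v} M) : A.B2 ≤ A.Z2 := by
  rintro _ ⟨δ, hδ, rfl⟩
  have hδ : δ 1 = 0 := hδ
  have key : ∀ {x y : M} (h : x = y), δ y = A.tr h (δ x) := by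
    rintro x _ rfl; exact (A.tr_rfl _ _).symm
  refine ⟨fun a => ⟨?_, ?_⟩, ?_⟩
  · change A.lstar 1 rfl (δ a) - δ (1 * a) + A.rstar a rfl (δ 1) = 0
    rw [hδ, map_zero, add_zero, key (one_mul a).symm]
    exact sub_self _
  · change A.lstar a rfl (δ 1) - δ (a * 1) + A.rstar 1 rfl (δ a) = 0
    rw [hδ, map_zero, key (mul_one a).symm, zero_sub]
    exact neg_add_cancel _
  · change A.d2 (A.d1 δ) = 0
    funext a b c
    change A.lstar a _ (A.lstar b rfl (δ c) - δ (b * c) + A.rstar c rfl (δ b))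
      - (A.lstar (a * b) rfl (δ c) - δ (a * b * c) + A.rstar c rfl (δ (a * b)))
      + A.tr _ (A.lstar a rfl (δ (b * c)) - δ (a * (b * c)) + A.rstar (b * c) rfl (δ a))
      - A.rstar c rfl (A.lstar a rfl (δ b) - δ (a * b) + A.rstar b rfl (δ a)) = 0
    rw [key (mul_assoc a b c)]
    simp only [map_add, map_sub, lstar, rstar, tr, act_act, one_mul, mul_one, act_one]
    abel

lemma B3_le_Z3 (A : DMod.{u, v} M) : A.B3 ≤ A.Z3 := by
  rintro _ ⟨φ, hφ, rfl⟩
  have key : ∀ {x x' y y' : M} (h : x = x') (h' : y = y'),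
      φ x' y' = A.tr (by rw [h, h']) (φ x y) := by
    rintro x _ y _ rfl rfl; exact (A.tr_rfl _ _).symm
  refine ⟨fun a b => ⟨?_, ?_, ?_⟩, ?_⟩
  · change A.lstar 1 _ (φ a b) - φ (1 * a) b + A.tr _ (φ 1 (a * b)) - A.rstar b rfl (φ 1 a) = 0
    rw [(hφ _).1, (hφ _).1, map_zero, map_zero, key (one_mul a).symm rfl, add_zero, sub_zero]
    exact sub_self _
  · change A.lstar a _ (φ 1 b) - φ (a * 1) b + A.tr _ (φ a (1 * b)) - A.rstar b rfl (φ a 1) = 0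
    rw [(hφ _).1, (hφ _).2, map_zero, map_zero, key (mul_one a).symm rfl, zero_sub, sub_zero,
      key rfl (one_mul b).symm]
    simp only [tr, act_act, one_mul]
    exact neg_add_cancel _
  · change A.lstar a _ (φ b 1) - φ (a * b) 1 + A.tr _ (φ a (b * 1)) - A.rstar 1 rfl (φ a b) = 0
    rw [(hφ _).2, (hφ _).2, map_zero, key rfl (mul_one b).symm, sub_zero, zero_add]
    simp only [tr, rstar, act_act, one_mul]
    exact sub_self _
  · change A.d3 (A.d2 φ) = 0
    funext a b c d
    change A.lstar a _ (A.lstar b _ (φ c d) - φ (b * c) d + A.tr _ (φ b (c * d))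
          - A.rstar d rfl (φ b c))
      - (A.lstar (a * b) _ (φ c d) - φ (a * b * c) d + A.tr _ (φ (a * b) (c * d))
          - A.rstar d rfl (φ (a * b) c))
      + A.tr _ (A.lstar a _ (φ (b * c) d) - φ (a * (b * c)) d + A.tr _ (φ a (b * c * d))
          - A.rstar d rfl (φ a (b * c)))
      - A.tr _ (A.lstar a _ (φ b (c * d)) - φ (a * b) (c * d) + A.tr _ (φ a (b * (c * d)))
          - A.rstar (c * d) rfl (φ a b))
      + A.rstar d rfl (A.lstar a _ (φ b c) - φ (a * b) c + A.tr _ (φ a (b * c))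
          - A.rstar c rfl (φ a b)) = 0
    rw [key (mul_assoc a b c) rfl, key rfl (mul_assoc b c d)]
    simp only [map_add, map_sub, lstar, rstar, tr, act_act, one_mul, mul_one, act_one]
    abel

/-- The second Leech cohomology group `H²(M, A)`. -/
def H2 (A : DMod.{u, v} M) : Type (max u v) := A.Z2 ⧸ A.B2.addSubgroupOf A.Z2
/-- The third Leech cohomology group `H³(M, A)`. -/
def H3 (A : DMod.{u, v} M) : Type (max u v) := A.Z3 ⧸ A.B3.addSubgroupOf A.Z3

instance (A : DMod.{u, v} M) : AddCommGroup A.H2 :=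
  inferInstanceAs (AddCommGroup (A.Z2 ⧸ A.B2.addSubgroupOf A.Z2))
instance (A : DMod.{u, v} M) : AddCommGroup A.H3 :=
  inferInstanceAs (AddCommGroup (A.Z3 ⧸ A.B3.addSubgroupOf A.Z3))

/-- The cohomology class of a 3-cocycle. -/
def H3.cls {A : DMod.{u, v} M} (μ : A.Z3) : A.H3 :=
  QuotientAddGroup.mk (s := A.B3.addSubgroupOf A.Z3) μ

lemma H3.cls_eq_iff {A : DMod.{u, v} M} (μ ν : A.Z3) :
    H3.cls μ = H3.cls ν ↔ ∃ φ ∈ A.C2, (ν : A.Fam3) = μ + A.d2 φ := by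
  refine (QuotientAddGroup.eq (s := A.B3.addSubgroupOf A.Z3)).trans ?_
  rw [AddSubgroup.mem_addSubgroupOf]
  constructor
  · rintro ⟨φ, hφ, h⟩
    refine ⟨φ, hφ, ?_⟩
    rw [h]; simp
  · rintro ⟨φ, hφ, h⟩
    refine ⟨φ, hφ, ?_⟩
    simp [h]

lemma H3.cls_surj {A : DMod.{u, v} M} (c : A.H3) : ∃ μ, H3.cls μ = c :=
  QuotientAddGroup.mk_surjective c

/-- `q_*` on cocycles: `(q_* λ)_{a,b,c} = q_{abc}(λ_{a,b,c})`. -/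
def Z3.push {A B : DMod.{u, v} M} (q : A ⟶ B) : A.Z3 →+ B.Z3 :=
  AddMonoidHom.mk' (fun μ => ⟨fun a b c => comp' q _ (μ.1 a b c), by
      intro a b
      obtain ⟨h1, h2, h3⟩ := μ.2.1 a b
      simp only [h1, h2, h3, map_zero, and_self], by
      have := μ.2.2
      change _ = 0 at this
      change _ = 0
      funext a b c d
      have := congrArg (comp' q _) (congrFun (congrFun (congrFun (congrFun this a) b) c) d)
      simpa [d3, lstar, rstar, tr, comp'_act] using this⟩) (by
    intro x y
    ext a b c
    exact map_add _ _ _)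

/-- `p^*` on cocycles: `(p^* λ')_{a,b,c} = λ'_{p(a),p(b),p(c)}`. -/
def Z3.pull (p : M →* M') (A' : DMod.{u', v} M') : A'.Z3 →+ (DMod.pull p A').Z3 :=
  AddMonoidHom.mk' (fun μ => ⟨fun a b c => A'.tr (by simp) (μ.1 (p a) (p b) (p c)), by
      have key : ∀ {x y z x' y' z' w : M'} (h : x' = x) (h' : y' = y) (h'' : z' = z)
          (k : x * y * z = w) (_ : μ.1 x' y' z' = 0), A'.tr k (μ.1 x y z) = 0 := by
        rintro x y z _ _ _ w rfl rfl rfl k h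
        rw [h, map_zero]
      intro a b
      obtain ⟨h1, h2, h3⟩ := μ.2.1 (p a) (p b)
      exact ⟨key (map_one p).symm rfl rfl _ h1, key rfl (map_one p).symm rfl _ h2,
        key rfl rfl (map_one p).symm _ h3⟩, by
      have := μ.2.2
      change _ = 0 at this
      change _ = 0
      have key : ∀ {x y z x' y' z' : M'} (h : x' = x) (h' : y' = y) (h'' : z' = z),
          μ.1 x y z = A'.tr (by rw [h, h', h'']) (μ.1 x' y' z') := by
        rintro x y z _ _ _ rfl rfl rfl
        exact (A'.tr_rfl _ _).symm
      funext a b c d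
      have := congrArg (A'.tr (y := p (a * b * c * d)) (by simp))
        (congrFun (congrFun (congrFun (congrFun this (p a)) (p b)) (p c)) (p d))
      simp only [d3, AddMonoidHom.mk'_apply, lstar, rstar, tr, pull_act, map_add, map_sub,
        act_act, map_one, one_mul, mul_one, Pi.zero_apply, map_zero] at this ⊢
      rw [key (map_mul p a b).symm rfl rfl, key rfl (map_mul p b c).symm rfl,
        key rfl rfl (map_mul p c d).symm]
      simp only [tr, act_act, one_mul]
      exact this⟩) (by
    intro x y
    ext a b c
    exact map_add _ _ _)

lemma B3_le_push {A B : DMod.{u, v} M} (q : A ⟶ B) :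
    A.B3.addSubgroupOf A.Z3 ≤ (B.B3.addSubgroupOf B.Z3).comap (Z3.push q) := by
  rintro ⟨_, hm⟩ ⟨φ, hφ, rfl⟩
  refine ⟨fun a b => comp' q _ (φ a b), fun a => by simp [(hφ a).1, (hφ a).2], ?_⟩
  funext a b c
  simp [Z3.push, d2, lstar, rstar, tr, comp'_act]

lemma B3_le_pull (p : M →* M') (A' : DMod.{u', v} M') :
    A'.B3.addSubgroupOf A'.Z3 ≤
      ((DMod.pull p A').B3.addSubgroupOf (DMod.pull p A').Z3).comap (Z3.pull p A') := by
  rintro ⟨_, hm⟩ ⟨φ, hφ, rfl⟩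
  have key : ∀ {x y x' y' : M'} (h : x' = x) (h' : y' = y),
      φ x y = A'.tr (by rw [h, h']) (φ x' y') := by
    rintro x y _ _ rfl rfl
    exact (A'.tr_rfl _ _).symm
  refine ⟨fun a b => A'.tr (map_mul p a b).symm (φ (p a) (p b)), fun a => ⟨?_, ?_⟩, ?_⟩
  · change A'.tr _ (φ (p 1) (p a)) = 0
    rw [key (map_one p).symm rfl, (hφ _).1, map_zero, map_zero]
  · change A'.tr _ (φ (p a) (p 1)) = 0
    rw [key rfl (map_one p).symm, (hφ _).2, map_zero, map_zero]
  · funext a b c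
    change _ = A'.tr _ (A'.d2 φ (p a) (p b) (p c))
    simp only [ d2, AddMonoidHom.mk'_apply, lstar, rstar, tr, pull_act, map_add, map_sub,
      act_act, map_one, one_mul, mul_one]
    rw [key (map_mul p a b).symm rfl, key rfl (map_mul p b c).symm]
    simp only [tr, act_act, one_mul]
    rfl

/-- `q_* : H³(M, A) ⟶ H³(M, B)` for a morphism `q : A ⟶ B` of `𝔻M`-modules. -/
def H3.push {A B : DMod.{u, v} M} (q : A ⟶ B) : A.H3 →+ B.H3 :=
  QuotientAddGroup.map _ _ (Z3.push q) (B3_le_push q)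

/-- `p^* : H³(M', A') ⟶ H³(M, p^* A')` for a monoid homomorphism `p : M ⟶ M'`. -/
def H3.pull (p : M →* M') (A' : DMod.{u', v} M') : A'.H3 →+ (DMod.pull p A').H3 :=
  QuotientAddGroup.map _ _ (Z3.pull p A') (B3_le_pull p A')

lemma H3.push_cls {A B : DMod.{u, v} M} (q : A ⟶ B) (μ : A.Z3) :
    H3.push q (H3.cls μ) = H3.cls (Z3.push q μ) := rfl

lemma H3.pull_cls (p : M →* M') (A' : DMod.{u', v} M') (μ : A'.Z3) :
    H3.pull p A' (H3.cls μ) = H3.cls (Z3.pull p A' μ) := rfl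

end DMod

/-! ### The category `H³Mnd` of Leech 3-cohomology classes -/

/-- Objects `(M, (A, Θ), c)` of `H³Mnd`. -/
structure H3Mnd : Type (max (u + 1) (v + 1)) where
  /-- the monoid -/
  M : Type u
  [monoid : Monoid M]
  /-- the module of coefficients -/
  A : DMod.{u, v} M
  /-- the cohomology class -/
  c : A.H3

attribute [instance] H3Mnd.monoid

/-- Morphisms `(p, q)` of `H³Mnd`. -/
structure H3Mnd.Hom (S T : H3Mnd.{u, v}) : Type (max u v) where
  /-- the monoid homomorphism -/
  p : S.M →* T.M
  /-- the morphism of modules `A ⟶ p^* A'` -/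
  q : S.A ⟶ DMod.pull p T.A
  comm : DMod.H3.pull p T.A T.c = DMod.H3.push q S.c

instance : Category.{max u v} H3Mnd.{u, v} where
  Hom S T := H3Mnd.Hom S T
  id S := ⟨MonoidHom.id S.M, 𝟙 S.A, by
    obtain ⟨μ, hμ⟩ := DMod.H3.cls_surj S.c
    rw [← hμ]
    change DMod.H3.cls (DMod.Z3.pull (MonoidHom.id S.M) S.A μ) = DMod.H3.cls μ
    congr 1
    ext a b c
    exact DMod.tr_rfl _ _ _⟩
  comp {S T U} f g := ⟨g.p.comp f.p, f.q ≫ Functor.whiskerLeft (dFunctor f.p) g.q, by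
    have h1 : ∀ d : U.A.H3, DMod.H3.pull (g.p.comp f.p) U.A d =
        DMod.H3.pull f.p (DMod.pull g.p U.A) (DMod.H3.pull g.p U.A d) := by
      intro d
      obtain ⟨μ, rfl⟩ := DMod.H3.cls_surj d
      simp only [DMod.H3.pull_cls]
      congr 1
      ext a b c
      simp only [DMod.Z3.pull, AddMonoidHom.mk'_apply, DMod.tr, DMod.pull_act]
      rw [DMod.act_act]
      simp only [map_one, one_mul]
      rfl
    have h2 : ∀ d : T.A.H3, DMod.H3.pull f.p (DMod.pull g.p U.A) (DMod.H3.push g.q d) =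
        DMod.H3.push (Functor.whiskerLeft (dFunctor f.p) g.q) (DMod.H3.pull f.p T.A d) := by
      intro d
      obtain ⟨μ, rfl⟩ := DMod.H3.cls_surj d
      simp only [DMod.H3.pull_cls, DMod.H3.push_cls]
      congr 1
      ext a b c
      exact (DMod.comp'_act g.q _ _).symm
    have h3 : ∀ d : S.A.H3, DMod.H3.push (f.q ≫ Functor.whiskerLeft (dFunctor f.p) g.q) d =
        DMod.H3.push (Functor.whiskerLeft (dFunctor f.p) g.q) (DMod.H3.push f.q d) := by
      intro d
      obtain ⟨μ, rfl⟩ := DMod.H3.cls_surj d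
      rfl
    rw [h1, g.comm, h2, f.comm]
    exact (h3 S.c).symm⟩
  id_comp f := rfl
  comp_id f := rfl
  assoc f g h := rfl

lemma H3Mnd.hom_ext {S T : H3Mnd.{u, v}} {f g : S ⟶ T} (hp : f.p = g.p)
    (hq : ∀ (a : S.M) (x : S.A.at' a),
      T.A.tr (by rw [hp]) (DMod.comp' f.q a x : T.A.at' (f.p a)) = DMod.comp' g.q a x) :
    f = g := by
  obtain ⟨p, q, hf⟩ := f
  obtain ⟨p', q', hg⟩ := g
  obtain rfl : p = p' := hp
  have : q = q' := by
    ext ⟨a⟩ x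
    exact (T.A.tr_rfl rfl _).symm.trans (hq a x)
  subst this
  rfl

/-! ### Monoidal abelian groupoids -/

/-- A groupoid is abelian if all its isotropy groups are abelian. -/
class AbelianGroupoid (G : Type u) [Groupoid.{v} G] : Prop where
  comm : ∀ {X : G} (f g : X ⟶ X), f ≫ g = g ≫ f

/-- The isotropy group of an object, as an abelian group written additively. -/
def autGrp {G : Type u} [Groupoid.{v} G] [AbelianGroupoid G] (X : G) : AddCommGrpCat.{v} :=
  letI : CommGroup (X ⟶ X) :=
    { Groupoid.vertexGroup X with mul_comm := AbelianGroupoid.comm }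
  AddCommGrpCat.of (Additive (X ⟶ X))

section autGrp

variable {G : Type u} [Groupoid.{v} G] [AbelianGroupoid G]

/-- An automorphism as an element of the isotropy group. -/
def toAut {X : G} (f : X ⟶ X) : autGrp X := Additive.ofMul f

/-- An element of the isotropy group as an automorphism. -/
def ofAut {X : G} (f : autGrp X) : X ⟶ X := Additive.toMul f

@[simp] lemma ofAut_toAut {X : G} (f : X ⟶ X) : ofAut (toAut f) = f := rfl
@[simp] lemma toAut_ofAut {X : G} (f : autGrp X) : toAut (ofAut f) = f := rfl
lemma toAut_comp {X : G} (f g : X ⟶ X) : toAut (f ≫ g) = toAut f + toAut g := rfl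
lemma toAut_id (X : G) : toAut (𝟙 X) = 0 := rfl
lemma ofAut_add {X : G} (f g : autGrp X) : ofAut (f + g) = ofAut f ≫ ofAut g := rfl
lemma toAut_inj {X : G} {f g : X ⟶ X} (h : toAut f = toAut g) : f = g := h

end autGrp

/-- A multiplicative map between isotropy groups as a morphism of abelian groups. -/
def autHom {G : Type u} [Groupoid.{v} G] [AbelianGroupoid G] {G' : Type u'} [Groupoid.{v} G']
    [AbelianGroupoid G'] {X : G} {Y : G'} (k : (X ⟶ X) → (Y ⟶ Y))
    (hk : ∀ f g, k (f ≫ g) = k f ≫ k g) : autGrp X ⟶ autGrp Y :=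
  AddCommGrpCat.ofHom (X := autGrp X) (Y := autGrp Y) (AddMonoidHom.mk' (fun f => toAut (k (ofAut f)))
    (fun f g => congrArg toAut (hk (ofAut f) (ofAut g))))

/-- Automorphisms of possibly different objects which correspond to each other under some
isomorphism of these objects. -/
def Sim {G : Type u} [Groupoid.{v} G] {X Y : G} (f : X ⟶ X) (g : Y ⟶ Y) : Prop :=
  ∃ t : X ⟶ Y, f ≫ t = t ≫ g

namespace Sim

variable {G : Type u} [Groupoid.{v} G]

lemma refl {X : G} (f : X ⟶ X) : Sim f f := ⟨𝟙 X, by simp⟩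

lemma eq [AbelianGroupoid G] {X : G} {f g : X ⟶ X} (h : Sim f g) : f = g := by
  obtain ⟨t, ht⟩ := h
  rw [AbelianGroupoid.comm t g] at ht
  exact (cancel_mono t).1 ht

lemma symm {X Y : G} {f : X ⟶ X} {g : Y ⟶ Y} (h : Sim f g) : Sim g f := by
  obtain ⟨t, ht⟩ := h
  exact ⟨inv t, by rw [← cancel_epi t, ← cancel_mono t]; simp [← ht]⟩

lemma trans {X Y Z : G} {f : X ⟶ X} {g : Y ⟶ Y} {k : Z ⟶ Z} (h : Sim f g) (h' : Sim g k) :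
    Sim f k := by
  obtain ⟨t, ht⟩ := h
  obtain ⟨s, hs⟩ := h'
  exact ⟨t ≫ s, by rw [← Category.assoc, ht, Category.assoc, hs, Category.assoc]⟩

lemma conj {X Y : G} (f : X ⟶ X) (t : X ⟶ Y) : Sim (inv t ≫ f ≫ t) f := ⟨inv t, by simp⟩

lemma map {G' : Type u'} [Groupoid.{v'} G'] (F : G ⥤ G') {X Y : G} {f : X ⟶ X} {g : Y ⟶ Y}
    (h : Sim f g) : Sim (F.map f) (F.map g) := by
  obtain ⟨t, ht⟩ := h
  exact ⟨F.map t, by rw [← F.map_comp, ht, F.map_comp]⟩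

variable [MonoidalCategory G]

lemma left {X Y Z W : G} {f : X ⟶ X} {g : Y ⟶ Y} (h : Sim f g) (e : Z ⟶ W) :
    Sim (Z ◁ f) (W ◁ g) := by
  obtain ⟨t, ht⟩ := h
  refine ⟨Z ◁ t ≫ e ▷ Y, ?_⟩
  rw [← Category.assoc, ← MonoidalCategory.whiskerLeft_comp, ht, Category.assoc,
    ← whisker_exchange, MonoidalCategory.whiskerLeft_comp, Category.assoc]

lemma right {X Y Z W : G} {f : X ⟶ X} {g : Y ⟶ Y} (h : Sim f g) (e : Z ⟶ W) :
    Sim (f ▷ Z) (g ▷ W) := by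
  obtain ⟨t, ht⟩ := h
  refine ⟨t ▷ Z ≫ Y ◁ e, ?_⟩
  rw [← Category.assoc, ← MonoidalCategory.comp_whiskerRight, ht, Category.assoc,
    whisker_exchange, MonoidalCategory.comp_whiskerRight, Category.assoc]

lemma left_left {X : G} (Z W : G) (f : X ⟶ X) : Sim (Z ◁ (W ◁ f)) ((Z ⊗ W) ◁ f) :=
  ⟨(α_ Z W X).inv, by simp⟩

lemma right_right {X : G} (Z W : G) (f : X ⟶ X) : Sim ((f ▷ Z) ▷ W) (f ▷ (Z ⊗ W)) :=
  ⟨(α_ X Z W).hom, by simp⟩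

lemma left_right {X : G} (Z W : G) (f : X ⟶ X) : Sim ((Z ◁ f) ▷ W) (Z ◁ (f ▷ W)) :=
  ⟨(α_ Z X W).hom, by simp⟩

lemma unit_left {X : G} (f : X ⟶ X) : Sim (𝟙_ G ◁ f) f := ⟨(λ_ X).hom, by simp⟩

lemma unit_right {X : G} (f : X ⟶ X) : Sim (f ▷ 𝟙_ G) f := ⟨(ρ_ X).hom, by simp⟩

end Sim

/-- The set `M(G)` of isomorphism classes of objects. -/
def IsoClass (G : Type u) [Category.{v} G] : Type u := Quotient (isIsomorphicSetoid G)

namespace IsoClass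

/-- The isomorphism class of an object. -/
def mk {G : Type u} [Category.{v} G] (X : G) : IsoClass G := Quotient.mk (isIsomorphicSetoid G) X

lemma mk_eq_mk {G : Type u} [Category.{v} G] {X Y : G} : mk X = mk Y ↔ Nonempty (X ≅ Y) :=
  Quotient.eq (r := isIsomorphicSetoid G)

lemma exists_mk {G : Type u} [Category.{v} G] (a : IsoClass G) : ∃ X, mk X = a :=
  Quotient.exists_rep a

/-- The monoid structure on `M(G)`: `[X] [Y] = [X ⊗ Y]`, with unit `[I]`. -/
instance {G : Type u} [Category.{v} G] [MonoidalCategory G] : Monoid (IsoClass G) where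
  mul := Quotient.map₂ (fun X Y => X ⊗ Y) (by
    rintro X X' ⟨e⟩ Y Y' ⟨e'⟩
    exact ⟨e ⊗ᵢ e'⟩)
  one := mk (𝟙_ G)
  mul_assoc := by
    rintro ⟨X⟩ ⟨Y⟩ ⟨Z⟩
    exact mk_eq_mk.2 ⟨α_ X Y Z⟩
  one_mul := by
    rintro ⟨X⟩
    exact mk_eq_mk.2 ⟨λ_ X⟩
  mul_one := by
    rintro ⟨X⟩
    exact mk_eq_mk.2 ⟨ρ_ X⟩

lemma mk_tensor {G : Type u} [Category.{v} G] [MonoidalCategory G] (X Y : G) :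
    mk (X ⊗ Y) = mk X * mk Y := rfl

lemma mk_unit {G : Type u} [Category.{v} G] [MonoidalCategory G] : mk (𝟙_ G) = 1 := rfl

/-- The homomorphism `M(F) : [X] ↦ [F X]` induced by a monoidal functor. -/
def map {G : Type u} [Category.{v} G] [MonoidalCategory G] {G' : Type u'} [Category.{v'} G']
    [MonoidalCategory G'] (F : G ⥤ G') [F.Monoidal] : IsoClass G →* IsoClass G' where
  toFun := Quotient.map F.obj (by
    rintro X Y ⟨e⟩
    exact ⟨F.mapIso e⟩)
  map_one' := mk_eq_mk.2 ⟨(Functor.Monoidal.εIso F).symm⟩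
  map_mul' := by
    rintro ⟨X⟩ ⟨Y⟩
    exact mk_eq_mk.2 ⟨(Functor.Monoidal.μIso F X Y).symm⟩

lemma map_mk {G : Type u} [Category.{v} G] [MonoidalCategory G] {G' : Type u'} [Category.{v'} G']
    [MonoidalCategory G'] (F : G ⥤ G') [F.Monoidal] (X : G) : map F (mk X) = mk (F.obj X) := rfl

end IsoClass

/-- A cleavage of a monoidal groupoid `G` over `M(G)`: a choice of representatives `X_a` with
`X_1 = I`, of isomorphisms `Γ_X : X ⟶ X_a` for `X` in the class `a`, with `Γ_{X_a} = 1`, and of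
isomorphisms `γ_{a,b} : X_a ⊗ X_b ⟶ X_{ab}` which are the unit constraints for `a = 1` or `b = 1`.
The isomorphism `γ_{a,b}` is the one denoted by `Γ` at the object `X_a ⊗ X_b`; it is attached to
the pair `(a, b)` since distinct pairs may have the same tensor product object, on which the
normalization conditions can then disagree. -/
structure Cleavage (G : Type u) [Groupoid.{v} G] [MonoidalCategory G] where
  /-- the representative `X_a` -/
  obj : IsoClass G → G
  mk_obj : ∀ a, IsoClass.mk (obj a) = a
  obj_one : obj 1 = 𝟙_ G
  /-- the isomorphism `X ⟶ X_a` for `X ∈ a` -/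
  Γ : ∀ (X : G) {a : IsoClass G}, IsoClass.mk X = a → (X ⟶ obj a)
  Γ_obj : ∀ a, Γ (obj a) (mk_obj a) = 𝟙 (obj a)
  /-- the isomorphism `X_a ⊗ X_b ⟶ X_c` for `c = ab` -/
  γ : ∀ {a b c : IsoClass G}, a * b = c → (obj a ⊗ obj b ⟶ obj c)
  γ_one_left : ∀ a, γ (one_mul a) = eqToHom obj_one ▷ obj a ≫ (λ_ (obj a)).hom
  γ_one_right : ∀ a, γ (mul_one a) = obj a ◁ eqToHom obj_one ≫ (ρ_ (obj a)).hom

/-- Every monoidal groupoid has a cleavage. -/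
instance (G : Type u) [Groupoid.{v} G] [MonoidalCategory G] : Nonempty (Cleavage G) := by
  classical
  have h1 : ∀ a : IsoClass G, ∃ X : G, IsoClass.mk X = a ∧ (a = 1 → X = 𝟙_ G) := by
    intro a
    by_cases h : a = 1
    · exact ⟨𝟙_ G, h.symm ▸ rfl, fun _ => rfl⟩
    · obtain ⟨X, hX⟩ := a.exists_mk
      exact ⟨X, hX, fun h' => absurd h' h⟩
  choose obj mk_obj obj_one using h1
  have obj_one := obj_one 1 rfl
  have h2 : ∀ (X : G) (a : IsoClass G) (_ : IsoClass.mk X = a),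
      ∃ t : X ⟶ obj a, ∀ h : X = obj a, t = eqToHom h := by
    intro X a hX
    by_cases h : X = obj a
    · exact ⟨eqToHom h, fun _ => rfl⟩
    · obtain ⟨e⟩ := IsoClass.mk_eq_mk.1 (hX.trans (mk_obj a).symm)
      exact ⟨e.hom, fun h' => absurd h' h⟩
  choose Γ hΓ using h2
  have h3 : ∀ (a b : IsoClass G), ∃ t : obj a ⊗ obj b ⟶ obj (a * b),
      (∀ h : a = 1, t = eqToHom (by rw [h, obj_one]) ▷ obj b ≫ (λ_ (obj b)).hom ≫
        eqToHom (by rw [h, one_mul])) ∧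
      (∀ h : b = 1, t = obj a ◁ eqToHom (by rw [h, obj_one]) ≫ (ρ_ (obj a)).hom ≫
        eqToHom (by rw [h, mul_one])) := by
    intro a b
    by_cases h : a = 1
    · subst h
      refine ⟨eqToHom obj_one ▷ obj b ≫ (λ_ (obj b)).hom ≫ eqToHom (by rw [one_mul]),
        fun _ => rfl, ?_⟩
      rintro rfl
      have key : ∀ (X : G) (h : X = 𝟙_ G),
          eqToHom h ▷ X ≫ (λ_ X).hom = X ◁ eqToHom h ≫ (ρ_ X).hom := by
        rintro _ rfl
        simp [unitors_equal]
      rw [← Category.assoc, key _ obj_one, Category.assoc]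
    · by_cases h' : b = 1
      · subst h'
        exact ⟨obj a ◁ eqToHom obj_one ≫ (ρ_ (obj a)).hom ≫ eqToHom (by rw [mul_one]),
          fun k => absurd k h, fun _ => rfl⟩
      · obtain ⟨e⟩ := IsoClass.mk_eq_mk.1
          (show IsoClass.mk (obj a ⊗ obj b) = IsoClass.mk (obj (a * b)) by
            rw [IsoClass.mk_tensor, mk_obj, mk_obj, mk_obj])
        exact ⟨e.hom, fun k => absurd k h, fun k => absurd k h'⟩
  choose γ hγ using h3
  exact ⟨{
    obj := obj
    mk_obj := mk_obj
    obj_one := obj_one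
    Γ := fun X a h => Γ X a h
    Γ_obj := fun a => by rw [hΓ _ _ _ rfl]; rfl
    γ := fun {a b c} h => γ a b ≫ eqToHom (by rw [h])
    γ_one_left := fun a => by rw [(hγ 1 a).1 rfl]; simp
    γ_one_right := fun a => by rw [(hγ a 1).2 rfl]; simp }⟩

namespace Cleavage

variable {G : Type u} [Groupoid.{v} G] [MonoidalCategory G] (κ : Cleavage G)

/-- `a_*(f) : X_y ⟶ X_y` for `f : X_x ⟶ X_x` and `y = a x`: the automorphism with
`(1 ⊗ f) γ = γ a_*(f)`. -/
def lst (a : IsoClass G) {x y : IsoClass G} (h : a * x = y) (f : κ.obj x ⟶ κ.obj x) :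
    κ.obj y ⟶ κ.obj y := inv (κ.γ h) ≫ κ.obj a ◁ f ≫ κ.γ h

/-- `b^*(g) : X_y ⟶ X_y` for `g : X_x ⟶ X_x` and `y = x b`: the automorphism with
`(g ⊗ 1) γ = γ b^*(g)`. -/
def rst (b : IsoClass G) {x y : IsoClass G} (h : x * b = y) (g : κ.obj x ⟶ κ.obj x) :
    κ.obj y ⟶ κ.obj y := inv (κ.γ h) ≫ g ▷ κ.obj b ≫ κ.γ h

lemma lst_comp (a : IsoClass G) {x y : IsoClass G} (h : a * x = y) (f g : κ.obj x ⟶ κ.obj x) :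
    κ.lst a h (f ≫ g) = κ.lst a h f ≫ κ.lst a h g := by simp [lst]

lemma rst_comp (a : IsoClass G) {x y : IsoClass G} (h : x * a = y) (f g : κ.obj x ⟶ κ.obj x) :
    κ.rst a h (f ≫ g) = κ.rst a h f ≫ κ.rst a h g := by simp [rst]

lemma γ_lst (a : IsoClass G) {x y : IsoClass G} (h : a * x = y) (f : κ.obj x ⟶ κ.obj x) :
    κ.γ h ≫ κ.lst a h f = κ.obj a ◁ f ≫ κ.γ h := by simp [lst]

lemma γ_rst (a : IsoClass G) {x y : IsoClass G} (h : x * a = y) (f : κ.obj x ⟶ κ.obj x) :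
    κ.γ h ≫ κ.rst a h f = f ▷ κ.obj a ≫ κ.γ h := by simp [rst]

lemma lst_sim (a : IsoClass G) {x y : IsoClass G} (h : a * x = y) (f : κ.obj x ⟶ κ.obj x) :
    Sim (κ.lst a h f) (κ.obj a ◁ f) := Sim.conj _ _

lemma rst_sim (a : IsoClass G) {x y : IsoClass G} (h : x * a = y) (f : κ.obj x ⟶ κ.obj x) :
    Sim (κ.rst a h f) (f ▷ κ.obj a) := Sim.conj _ _

lemma exists_hom {a : IsoClass G} {X : G} (h : IsoClass.mk X = a) :
    Nonempty (X ⟶ κ.obj a) := ⟨κ.Γ X h⟩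

/-- The `𝔻M(G)`-module `(A(G), Θ(G))` of a monoidal abelian groupoid: `A_a = Aut(X_a)`, and the
arrow `(l, x, r)` acts by `l_* r^*`. -/
def module [AbelianGroupoid G] : DMod.{u, v} (IsoClass G) where
  obj x := autGrp (κ.obj x.elt)
  map {x y} t := autHom (fun f => κ.lst t.l (by rw [← mul_assoc, t.eq]) (κ.rst t.r rfl f))
    (fun f g => by rw [rst_comp, lst_comp])
  map_id x := by
    ext f
    refine congrArg toAut (Sim.eq (g := ofAut f) ?_)
    refine (κ.lst_sim (1 : IsoClass G) _ _).trans ?_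
    rw [κ.obj_one]
    refine (Sim.unit_left _).trans ((κ.rst_sim (1 : IsoClass G) _ _).trans ?_)
    rw [κ.obj_one]
    exact Sim.unit_right _
  map_comp {x y z} s t := by
    ext f
    refine congrArg toAut (Sim.eq (f := κ.lst (t.l * s.l) _ (κ.rst (s.r * t.r) _ (ofAut f)))
      (g := κ.lst t.l _ (κ.rst t.r _ (κ.lst s.l _ (κ.rst s.r _ (ofAut f))))) ?_)
    refine (κ.lst_sim _ _ _).trans (((κ.rst_sim _ _ _).left (inv (κ.γ rfl))).trans ?_)
    refine (((Sim.refl (ofAut f)).right (inv (κ.γ rfl))).left (𝟙 _)).trans ?_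
    refine ((Sim.right_right _ _ _).symm.left (𝟙 _)).trans ?_
    refine Sim.trans ?_ (κ.lst_sim _ _ _).symm
    refine Sim.trans ?_ ((κ.rst_sim _ _ _).left (𝟙 _)).symm
    refine Sim.trans ?_ (((κ.lst_sim _ _ _).right (𝟙 _)).left (𝟙 _)).symm
    refine Sim.trans ?_ ((((κ.rst_sim _ _ _).left (𝟙 _)).right (𝟙 _)).left (𝟙 _)).symm
    refine Sim.trans ?_ ((Sim.left_right _ _ _).left (𝟙 _)).symm
    exact (Sim.left_left _ _ _).symm

end Cleavage
namespace Cleavage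

variable {G : Type u} [Groupoid.{v} G] [MonoidalCategory G] (κ : Cleavage G)

/-- The automorphism `λ_{a,b,c}` of `X_x`, `x = abc`, which is determined by
`(γ_{a,b} ⊗ 1) γ_{ab,c} λ_{a,b,c} = α (1 ⊗ γ_{b,c}) γ_{a,bc}` (composition from left to right). -/
def lam (a b c : IsoClass G) {x : IsoClass G} (h : a * b * c = x) : κ.obj x ⟶ κ.obj x :=
  inv (κ.γ (rfl : a * b = a * b) ▷ κ.obj c ≫ κ.γ h) ≫ (α_ (κ.obj a) (κ.obj b) (κ.obj c)).hom ≫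
    κ.obj a ◁ κ.γ (rfl : b * c = b * c) ≫ κ.γ (by rw [← mul_assoc, h])

lemma γ_lam (a b c : IsoClass G) {p q x : IsoClass G} (hp : a * b = p) (hq : b * c = q)
    (h : p * c = x) (h' : a * q = x) (h'' : a * b * c = x) :
    κ.γ hp ▷ κ.obj c ≫ κ.γ h ≫ κ.lam a b c h'' =
      (α_ (κ.obj a) (κ.obj b) (κ.obj c)).hom ≫ κ.obj a ◁ κ.γ hq ≫ κ.γ h' := by
  subst hp hq
  simp [lam]

lemma γ_left (a b : IsoClass G) {c : IsoClass G} (ha : a = 1) (hb : b = c) (h : a * b = c) :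
    κ.γ h = eqToHom (by rw [ha, κ.obj_one]) ▷ κ.obj b ≫ (λ_ (κ.obj b)).hom ≫
      eqToHom (by rw [hb]) := by
  subst ha hb
  rw [κ.γ_one_left]
  simp

lemma γ_right (a b : IsoClass G) {c : IsoClass G} (hb : b = 1) (ha : a = c) (h : a * b = c) :
    κ.γ h = κ.obj a ◁ eqToHom (by rw [hb, κ.obj_one]) ≫ (ρ_ (κ.obj a)).hom ≫
      eqToHom (by rw [ha]) := by
  subst ha hb
  rw [κ.γ_one_right]
  simp

lemma lam_one_left (b c : IsoClass G) {x : IsoClass G} (h : 1 * b * c = x) :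
    κ.lam 1 b c h = 𝟙 _ := by
  have hx : b * c = x := by rw [← h, one_mul]
  subst hx
  have := κ.γ_lam 1 b c (one_mul b) rfl rfl (one_mul _) h
  rw [← cancel_epi (κ.γ (one_mul b) ▷ κ.obj c ≫ κ.γ rfl), Category.assoc, this]
  rw [κ.γ_one_left, κ.γ_one_left, Category.comp_id, whisker_exchange_assoc]
  simp

lemma lam_one_mid (a c : IsoClass G) {x : IsoClass G} (h : a * 1 * c = x) :
    κ.lam a 1 c h = 𝟙 _ := by
  have hx : a * c = x := by rw [← h, mul_one]
  subst hx
  have := κ.γ_lam a 1 c (mul_one a) (one_mul c) rfl rfl h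
  rw [← cancel_epi (κ.γ (mul_one a) ▷ κ.obj c ≫ κ.γ rfl), Category.assoc, this]
  rw [κ.γ_one_left, κ.γ_one_right, Category.comp_id]
  generalize eqToHom κ.obj_one = e
  simp

lemma lam_one_right (a b : IsoClass G) {x : IsoClass G} (h : a * b * 1 = x) :
    κ.lam a b 1 h = 𝟙 _ := by
  have hx : a * b = x := by rw [← h, mul_one]
  subst hx
  have := κ.γ_lam a b 1 rfl (mul_one b) (mul_one _) rfl h
  rw [← cancel_epi (κ.γ rfl ▷ κ.obj 1 ≫ κ.γ (mul_one _)), Category.assoc, this]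
  rw [κ.γ_one_right, κ.γ_one_right, Category.comp_id, ← whisker_exchange_assoc]
  generalize eqToHom κ.obj_one = e
  simp

lemma lam_cocycle (a b c d : IsoClass G) {x y z p q : IsoClass G} (hx : a * b * c = x)
    (hy : b * c * d = y) (hp : b * c = p) (hq : c * d = q) (hz : x * d = z) (h1 : a * y = z)
    (h2 : a * p * d = z) (h3 : a * b * q = z) (h4 : a * b * c * d = z) :
    κ.rst d hz (κ.lam a b c hx) ≫ κ.lam a p d h2 ≫ κ.lst a h1 (κ.lam b c d hy) =
      κ.lam (a * b) c d h4 ≫ κ.lam a b q h3 := by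
  have hap : a * p = x := by rw [← hp, ← mul_assoc, hx]
  have hpd : p * d = y := by rw [← hp, hy]
  have hbq : b * q = y := by rw [← hq, ← mul_assoc, hy]
  rw [← cancel_epi ((κ.γ rfl ▷ κ.obj c ≫ κ.γ hx) ▷ κ.obj d ≫ κ.γ hz)]
  trans (α_ (κ.obj a) (κ.obj b) (κ.obj c)).hom ▷ κ.obj d ≫
    (α_ (κ.obj a) (κ.obj b ⊗ κ.obj c) (κ.obj d)).hom ≫
    κ.obj a ◁ ((α_ (κ.obj b) (κ.obj c) (κ.obj d)).hom ≫ κ.obj b ◁ κ.γ hq ≫ κ.γ hbq) ≫ κ.γ h1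
  · simp only [Category.assoc]
    rw [reassoc_of% (κ.γ_rst d hz (κ.lam a b c hx)), ← comp_whiskerRight_assoc, Category.assoc,
      κ.γ_lam a b c rfl hp hx hap hx]
    simp only [comp_whiskerRight, Category.assoc]
    rw [reassoc_of% (κ.γ_lam a p d hap hpd hz h1 h2), κ.γ_lst a h1,
      ← κ.γ_lam b c d hp hq hpd hbq hy]
    simp
  · simp only [Category.assoc, comp_whiskerRight]
    rw [reassoc_of% (κ.γ_lam (a * b) c d hx hq hz h3 h4), associator_naturality_left_assoc,
      ← whisker_exchange_assoc, κ.γ_lam a b q rfl hbq h3 h1 h3]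
    simp

section Abelian

variable [AbelianGroupoid G]

lemma lstar_toAut (a : IsoClass G) {x y : IsoClass G} (h : a * x = y) (f : κ.obj x ⟶ κ.obj x) :
    κ.module.lstar a h (toAut f) = toAut (κ.lst a h f) := by
  refine congrArg toAut (Sim.eq (f := κ.lst a _ (κ.rst 1 _ f)) ?_)
  refine (κ.lst_sim _ _ _).trans (Sim.trans ?_ (κ.lst_sim _ _ _).symm)
  refine ((κ.rst_sim _ _ _).trans ?_).left (𝟙 _)
  rw [κ.obj_one]
  exact Sim.unit_right _

lemma rstar_toAut (a : IsoClass G) {x y : IsoClass G} (h : x * a = y) (f : κ.obj x ⟶ κ.obj x) :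
    κ.module.rstar a h (toAut f) = toAut (κ.rst a h f) := by
  refine congrArg toAut (Sim.eq (f := κ.lst 1 _ (κ.rst a _ f)) ?_)
  refine (κ.lst_sim _ _ _).trans ?_
  rw [κ.obj_one]
  refine (Sim.unit_left _).trans ((κ.rst_sim _ _ _).trans (κ.rst_sim _ _ _).symm)

lemma tr_lam (a b c : IsoClass G) {x y : IsoClass G} (h : a * b * c = x) (h' : x = y) :
    κ.module.tr h' (toAut (κ.lam a b c h)) = toAut (κ.lam a b c (h.trans h')) := by
  subst h'
  exact κ.module.tr_rfl _ _

lemma tr_eq_of_sim {x y : IsoClass G} (h : x = y) {f : κ.obj x ⟶ κ.obj x}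
    {g : κ.obj y ⟶ κ.obj y} (hs : Sim f g) : κ.module.tr h (toAut f) = toAut g := by
  subst h
  exact (κ.module.tr_rfl _ _).trans (congrArg toAut hs.eq)

/-- The 3-cocycle `λ(G)` of a monoidal abelian groupoid. -/
def cocycle : κ.module.Z3 := ⟨fun a b c => toAut (κ.lam a b c rfl), by
    intro a b
    refine ⟨congrArg toAut (κ.lam_one_left _ _ _), congrArg toAut (κ.lam_one_mid _ _ _),
      congrArg toAut (κ.lam_one_right _ _ _)⟩, by
    change _ = 0
    funext a b c d
    have key : ∀ {l m n p q : autGrp (κ.obj (a * b * c * d))}, q + (n + l) = m + p →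
        l - m + n - p + q = 0 := by
      intro l m n p q h
      have : l - m + n - p + q = (q + (n + l)) - (m + p) := by abel
      rw [this, h, sub_self]
    refine key ?_
    have e1 := κ.lstar_toAut a (show a * (b * c * d) = a * b * c * d by simp only [mul_assoc])
      (κ.lam b c d rfl)
    have e2 := κ.rstar_toAut d (rfl : a * b * c * d = _) (κ.lam a b c rfl)
    have e3 := κ.tr_lam a (b * c) d rfl
      (show a * (b * c) * d = a * b * c * d by simp only [mul_assoc])
    have e4 := κ.tr_lam a b (c * d) rfl
      (show a * b * (c * d) = a * b * c * d by simp only [mul_assoc])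
    have e5 := congrArg toAut (κ.lam_cocycle a b c d rfl rfl rfl rfl (rfl : a * b * c * d = _)
      (by simp only [mul_assoc]) (by simp only [mul_assoc]) (by simp only [mul_assoc]) rfl)
    let s : autGrp (κ.obj (a * b * c * d)) → autGrp (κ.obj (a * b * c * d)) →
      autGrp (κ.obj (a * b * c * d)) := fun l m => l + m
    exact (congrArg₂ s e2 (congrArg₂ s e3 e1)).trans (e5.trans (congrArg₂ s rfl e4).symm)⟩

end Abelian

/-! ### The action of monoidal functors -/

section Functor

variable {G' : Type u'} [Groupoid.{v} G'] [MonoidalCategory G'] (κ' : Cleavage G')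
  (F : G ⥤ G') [F.Monoidal]

lemma mk_map_obj (a : IsoClass G) :
    IsoClass.mk (F.obj (κ.obj a)) = IsoClass.map F a := by
  conv_rhs => rw [← κ.mk_obj a]
  rfl

/-- `q_a(f)` for `f : X_a ⟶ X_a`: the automorphism of `X'_{p(a)}`, `p = M(F)`, such that
`F(f) Γ' = Γ' q_a(f)`. -/
def qMap {a : IsoClass G} (f : κ.obj a ⟶ κ.obj a) :
    κ'.obj (IsoClass.map F a) ⟶ κ'.obj (IsoClass.map F a) :=
  inv (κ'.Γ _ (κ.mk_map_obj F a)) ≫ F.map f ≫ κ'.Γ _ (κ.mk_map_obj F a)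

lemma qMap_comp {a : IsoClass G} (f g : κ.obj a ⟶ κ.obj a) :
    κ.qMap κ' F (f ≫ g) = κ.qMap κ' F f ≫ κ.qMap κ' F g := by simp [qMap]

lemma qMap_sim {a : IsoClass G} (f : κ.obj a ⟶ κ.obj a) : Sim (κ.qMap κ' F f) (F.map f) :=
  Sim.conj _ _

lemma Sim.map_left {X Z : G} (f : X ⟶ X) : Sim (F.map (Z ◁ f)) (F.obj Z ◁ F.map f) :=
  Sim.symm ⟨Functor.LaxMonoidal.μ F Z X, by simp⟩

lemma Sim.map_right {X Z : G} (f : X ⟶ X) : Sim (F.map (f ▷ Z)) (F.map f ▷ F.obj Z) :=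
  Sim.symm ⟨Functor.LaxMonoidal.μ F X Z, by simp⟩

/-- The morphism `q(F) : (A(G), Θ(G)) ⟶ p^* (A(G'), Θ(G'))` induced by a monoidal functor. -/
def qHom [AbelianGroupoid G] [AbelianGroupoid G'] : κ.module ⟶ DMod.pull (IsoClass.map F) κ'.module where
  app a := autHom (κ.qMap κ' F) (κ.qMap_comp κ' F)
  naturality x y t := by
    ext f
    refine congrArg toAut (Sim.eq (f := κ.qMap κ' F (κ.lst t.l _ (κ.rst t.r _ (ofAut f))))
      (g := κ'.lst (IsoClass.map F t.l) _ (κ'.rst (IsoClass.map F t.r) _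
        (κ.qMap κ' F (ofAut f)))) ?_)
    refine (κ.qMap_sim κ' F _).trans ?_
    refine ((κ.lst_sim _ _ _).map F).trans ?_
    refine (((κ.rst_sim _ _ _).left (𝟙 _)).map F).trans ?_
    refine (Sim.map_left F _).trans ?_
    refine Sim.trans ?_ (κ'.lst_sim _ _ _).symm
    refine Sim.trans (Sim.left ?_ (κ'.Γ _ (κ.mk_map_obj F _))) ((κ'.rst_sim _ _ _).left (𝟙 _)).symm
    refine (Sim.map_right F _).trans (Sim.right ?_ (κ'.Γ _ (κ.mk_map_obj F _)))
    exact (κ.qMap_sim κ' F _).symm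

lemma exists_unit_adapted : ∃ T : ∀ a : IsoClass G, F.obj (κ.obj a) ⟶ κ'.obj (IsoClass.map F a),
    T 1 = F.map (eqToHom κ.obj_one) ≫ Functor.OplaxMonoidal.η F ≫
      eqToHom (by rw [map_one, κ'.obj_one]) := by
  classical
  have : ∀ a : IsoClass G, ∃ t : F.obj (κ.obj a) ⟶ κ'.obj (IsoClass.map F a), ∀ h : a = 1,
      t = F.map (eqToHom (by rw [h, κ.obj_one])) ≫ Functor.OplaxMonoidal.η F ≫
      eqToHom (by rw [h, map_one, κ'.obj_one]) := by
    intro a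
    by_cases h : a = 1
    · exact ⟨F.map (eqToHom (by rw [h, κ.obj_one])) ≫ Functor.OplaxMonoidal.η F ≫
        eqToHom (by rw [h, map_one, κ'.obj_one]), fun _ => rfl⟩
    · exact ⟨κ'.Γ _ (κ.mk_map_obj F a), fun h' => absurd h' h⟩
  choose T hT using this
  exact ⟨T, hT 1 rfl⟩

section Phi

variable {F κ κ'} (T : ∀ a : IsoClass G, F.obj (κ.obj a) ⟶ κ'.obj (IsoClass.map F a))

/-- The element `φ_{a,b}` with `(T_a ⊗ T_b) γ' φ_{a,b} = μ F(γ) T_{ab}`. -/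
def phi (a b : IsoClass G) {x : IsoClass G} (h : a * b = x) :
    κ'.obj (IsoClass.map F x) ⟶ κ'.obj (IsoClass.map F x) :=
  inv ((T a ⊗ₘ T b) ≫ κ'.γ (by rw [← map_mul, h])) ≫
    Functor.LaxMonoidal.μ F _ _ ≫ F.map (κ.γ h) ≫ T x

lemma T_phi (a b : IsoClass G) {x : IsoClass G} (h : a * b = x)
    (h' : IsoClass.map F a * IsoClass.map F b = IsoClass.map F x) :
    (T a ⊗ₘ T b) ≫ κ'.γ h' ≫ phi T a b h =
      Functor.LaxMonoidal.μ F _ _ ≫ F.map (κ.γ h) ≫ T x := by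
  simp [phi]

lemma phi_one_left (hT : T 1 = F.map (eqToHom κ.obj_one) ≫ Functor.OplaxMonoidal.η F ≫
      eqToHom (by rw [map_one, κ'.obj_one])) (b : IsoClass G) {x : IsoClass G} (h : 1 * b = x) :
    phi T 1 b h = 𝟙 _ := by
  have hx : b = x := by rw [← h, one_mul]
  subst hx
  have h' : IsoClass.map F 1 * IsoClass.map F b = IsoClass.map F b := by rw [map_one, one_mul]
  rw [← cancel_epi ((T 1 ⊗ₘ T b) ≫ κ'.γ h'), Category.assoc, T_phi]
  have hT' : T 1 ≫ eqToHom (by rw [map_one, κ'.obj_one]) =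
      F.map (eqToHom κ.obj_one) ≫ Functor.OplaxMonoidal.η F := by rw [hT]; simp
  rw [κ.γ_one_left, κ'.γ_left _ _ (map_one _) rfl, Category.comp_id, MonoidalCategory.tensorHom_def', eqToHom_refl,
    Category.comp_id, Category.assoc, ← comp_whiskerRight_assoc, hT']
  generalize eqToHom κ.obj_one = e
  rw [whisker_exchange_assoc, leftUnitor_naturality]
  simp

lemma phi_one_right (hT : T 1 = F.map (eqToHom κ.obj_one) ≫ Functor.OplaxMonoidal.η F ≫
      eqToHom (by rw [map_one, κ'.obj_one])) (a : IsoClass G) {x : IsoClass G} (h : a * 1 = x) :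
    phi T a 1 h = 𝟙 _ := by
  have hx : a = x := by rw [← h, mul_one]
  subst hx
  have h' : IsoClass.map F a * IsoClass.map F 1 = IsoClass.map F a := by rw [map_one, mul_one]
  rw [← cancel_epi ((T a ⊗ₘ T 1) ≫ κ'.γ h'), Category.assoc, T_phi]
  have hT' : T 1 ≫ eqToHom (by rw [map_one, κ'.obj_one]) =
      F.map (eqToHom κ.obj_one) ≫ Functor.OplaxMonoidal.η F := by rw [hT]; simp
  rw [κ.γ_one_right, κ'.γ_right _ _ (map_one _) rfl, Category.comp_id, MonoidalCategory.tensorHom_def, eqToHom_refl,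
    Category.comp_id, Category.assoc, ← MonoidalCategory.whiskerLeft_comp_assoc, hT']
  generalize eqToHom κ.obj_one = e
  rw [← whisker_exchange_assoc, rightUnitor_naturality]
  simp

lemma phi_cocycle (a b c : IsoClass G) {p q x : IsoClass G} (hp : a * b = p) (hq : b * c = q)
    (hx : a * b * c = x) (h1 : p * c = x) (h2 : a * q = x)
    (k1 : IsoClass.map F p * IsoClass.map F c = IsoClass.map F x)
    (k2 : IsoClass.map F a * IsoClass.map F q = IsoClass.map F x)
    (k3 : IsoClass.map F a * IsoClass.map F b * IsoClass.map F c = IsoClass.map F x) :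
    κ'.lam (IsoClass.map F a) (IsoClass.map F b) (IsoClass.map F c) k3 ≫
      κ'.lst (IsoClass.map F a) k2 (phi T b c hq) ≫ phi T a q h2 =
    κ'.rst (IsoClass.map F c) k1 (phi T a b hp) ≫ phi T p c h1 ≫
      inv (T x) ≫ F.map (κ.lam a b c hx) ≫ T x := by
  have k4 : IsoClass.map F a * IsoClass.map F b = IsoClass.map F p := by rw [← map_mul, hp]
  have k5 : IsoClass.map F b * IsoClass.map F c = IsoClass.map F q := by rw [← map_mul, hq]
  rw [← cancel_epi (((T a ⊗ₘ T b) ⊗ₘ T c) ≫ κ'.γ k4 ▷ κ'.obj _ ≫ κ'.γ k1)]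
  trans (α_ _ _ _).hom ≫ F.obj (κ.obj a) ◁ (Functor.LaxMonoidal.μ F _ _ ≫ F.map (κ.γ hq)) ≫
    Functor.LaxMonoidal.μ F _ _ ≫ F.map (κ.γ h2) ≫ T x
  · simp only [Category.assoc]
    rw [reassoc_of% (κ'.γ_lam _ _ _ k4 k5 k1 k2 k3), associator_naturality_assoc,
      reassoc_of% (κ'.γ_lst _ k2 (phi T b c hq)), ← T_phi T a q h2 k2]
    have : ∀ {Z : G'} (f : F.obj (κ.obj b) ⊗ F.obj (κ.obj c) ⟶ Z) (g : Z ⟶ F.obj (κ.obj q)),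
        T a ⊗ₘ (f ≫ g ≫ T q) = F.obj (κ.obj a) ◁ (f ≫ g) ≫ (T a ⊗ₘ T q) := by
      intro Z f g
      rw [MonoidalCategory.tensorHom_def', MonoidalCategory.tensorHom_def']
      simp
    rw [← id_tensorHom (κ'.obj _) (κ'.γ k5), ← id_tensorHom]
    simp only [tensorHom_comp_tensorHom_assoc, Category.assoc, Category.comp_id, T_phi, this]
  · simp only [Category.assoc]
    rw [reassoc_of% (κ'.γ_rst _ k1 (phi T a b hp))]
    rw [← tensorHom_id, ← tensorHom_id]
    simp only [tensorHom_comp_tensorHom_assoc, Category.comp_id, T_phi]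
    have : ∀ {Z : G'} (f : F.obj (κ.obj a) ⊗ F.obj (κ.obj b) ⟶ Z) (g : Z ⟶ F.obj (κ.obj p)),
        (f ≫ g ≫ T p) ⊗ₘ T c = (f ≫ g) ▷ _ ≫ (T p ⊗ₘ T c) := by
      intro Z f g
      rw [MonoidalCategory.tensorHom_def, MonoidalCategory.tensorHom_def]
      simp
    rw [this, Category.assoc, reassoc_of% (T_phi T p c h1 k1)]
    simp only [IsIso.hom_inv_id_assoc]
    have key := congrArg F.map (κ.γ_lam a b c hp hq h1 h2 hx)
    simp only [Functor.map_comp] at key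
    simp only [comp_whiskerRight, Category.assoc, Functor.LaxMonoidal.μ_natural_left_assoc,
      reassoc_of% key, MonoidalCategory.whiskerLeft_comp,
      Functor.LaxMonoidal.μ_natural_right_assoc]
    simp

end Phi

lemma q_eq_conj [AbelianGroupoid G'] {a : IsoClass G} (f : κ.obj a ⟶ κ.obj a)
    (t : F.obj (κ.obj a) ⟶ κ'.obj (IsoClass.map F a)) :
    κ.qMap κ' F f = inv t ≫ F.map f ≫ t :=
  Sim.eq ((κ.qMap_sim κ' F f).trans (Sim.conj _ _).symm)

variable {F κ κ'} in
lemma tr_phi [AbelianGroupoid G']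
    (T : ∀ a : IsoClass G, F.obj (κ.obj a) ⟶ κ'.obj (IsoClass.map F a))
    (a b : IsoClass G) {x y : IsoClass G} (h : a * b = x) (h' : x = y) :
    (DMod.pull (IsoClass.map F) κ'.module).tr h' (toAut (phi T a b h) : autGrp _) =
      toAut (phi T a b (h.trans h')) := by
  subst h'
  exact DMod.tr_rfl _ _ _

/-- The class of the cocycle is preserved by `F`: `p^* [λ(G')] = q_* [λ(G)]`. -/
lemma pull_cocycle [AbelianGroupoid G] [AbelianGroupoid G'] :
    DMod.H3.pull (IsoClass.map F) κ'.module (DMod.H3.cls κ'.cocycle) =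
      DMod.H3.push (κ.qHom κ' F) (DMod.H3.cls κ.cocycle) := by
  rw [DMod.H3.pull_cls, DMod.H3.push_cls, DMod.H3.cls_eq_iff]
  obtain ⟨T, hT⟩ := κ.exists_unit_adapted κ' F
  refine ⟨fun a b => toAut (phi T a b rfl), fun a => ⟨congrArg toAut (phi_one_left T hT a rfl),
    congrArg toAut (phi_one_right T hT a rfl)⟩, ?_⟩
  funext a b c
  have key : ∀ {l p1 p2 p3 p4 m : autGrp (κ'.obj (IsoClass.map F (a * b * c)))},
      l + (p1 + p3) = p4 + (p2 + m) → m = l + (p1 - p2 + p3 - p4) := by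
    intro l p1 p2 p3 p4 m h
    have : m = (p4 + (p2 + m)) - p4 - p2 := by abel
    rw [this, ← h]
    abel
  refine key ?_
  have hm : IsoClass.map F a * IsoClass.map F b * IsoClass.map F c = IsoClass.map F (a * b * c) :=
    by simp
  have hm1 : IsoClass.map F a * IsoClass.map F (b * c) = IsoClass.map F (a * b * c) := by
    simp [mul_assoc]
  have e1 := κ'.tr_lam (IsoClass.map F a) (IsoClass.map F b) (IsoClass.map F c) rfl hm
  have e2 := κ'.lstar_toAut (IsoClass.map F a) hm1 (phi T b c rfl)
  have e3 := tr_phi T a (b * c) rfl (mul_assoc a b c).symm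
  have e4 := κ'.rstar_toAut (IsoClass.map F c) (map_mul (IsoClass.map F) (a * b) c).symm
    (phi T a b rfl)
  have e5 := congrArg toAut (κ.q_eq_conj κ' F (κ.lam a b c rfl) (T _))
  have e6 := congrArg toAut (phi_cocycle T a b c rfl rfl rfl rfl (mul_assoc a b c).symm
    (map_mul (IsoClass.map F) (a * b) c).symm hm1 hm)
  let s : autGrp (κ'.obj (IsoClass.map F (a * b * c))) →
    autGrp (κ'.obj (IsoClass.map F (a * b * c))) →
    autGrp (κ'.obj (IsoClass.map F (a * b * c))) := fun l m => l + m
  refine Eq.trans (congrArg₂ s e1 (congrArg₂ s ?_ e3)) (e6.trans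
    (congrArg₂ s ?_ (congrArg₂ s rfl e5)).symm)
  · refine Eq.trans ?_ e2
    exact DMod.pull_lstar _ _ _ hm1 _
  · refine Eq.trans ?_ e4
    exact DMod.pull_rstar _ _ _ (map_mul (IsoClass.map F) (a * b) c).symm _

end Functor

end Cleavage

/-- Monoidal abelian groupoids. -/
structure MonAbGpd : Type (max (u + 1) (v + 1)) where
  /-- the type of objects -/
  carrier : Type u
  [groupoid : Groupoid.{v} carrier]
  [monoidal : MonoidalCategory carrier]
  [abelian : AbelianGroupoid carrier]

attribute [instance] MonAbGpd.groupoid MonAbGpd.monoidal MonAbGpd.abelian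

/-- Monoidal functors (with invertible structure constraints). -/
structure MonAbGpd.Hom (G G' : MonAbGpd.{u, v}) : Type (max u v) where
  /-- the underlying functor -/
  functor : G.carrier ⥤ G'.carrier
  [monoidal : functor.Monoidal]

attribute [instance] MonAbGpd.Hom.monoidal

namespace MonAbGpd

lemma Hom.ext' {G G' : MonAbGpd.{u, v}} {F : G.carrier ⥤ G'.carrier} (i j : F.Monoidal)
    (h : i.ε = j.ε) (h' : ∀ X Y, i.μ X Y = j.μ X Y) : Hom.mk F (monoidal := i) =
      Hom.mk F (monoidal := j) := by
  congr
  have hη : i.η = j.η := by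
    have e1 := i.ε_η
    have e2 := j.ε_η
    rw [← cancel_epi i.ε]
    exact e1.trans (e2.symm.trans (by rw [h]))
  have hδ : ∀ X Y, i.δ X Y = j.δ X Y := by
    intro X Y
    rw [← cancel_epi (i.μ X Y)]
    exact (i.μ_δ X Y).trans ((j.μ_δ X Y).symm.trans (by rw [h']))
  apply Functor.Monoidal.ext
  · exact h
  · funext X Y; exact h' X Y
  · exact hη
  · funext X Y; exact hδ X Y

open Functor.LaxMonoidal in
/-- The category of monoidal abelian groupoids and monoidal functors. -/
instance : Category.{max u v} MonAbGpd.{u, v} where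
  Hom G G' := Hom G G'
  id G := ⟨𝟭 G.carrier⟩
  comp F F' := ⟨F.functor ⋙ F'.functor⟩
  id_comp F := Hom.ext' _ _ (by simp; rfl) (by intro X Y; simp; rfl)
  comp_id F := Hom.ext' _ _ (by simp; rfl) (by intro X Y; simp; rfl)
  assoc F F' F'' := Hom.ext' _ _
    (by
      change ε F''.functor ≫ F''.functor.map (ε F'.functor ≫ F'.functor.map (ε F.functor)) =
        (ε F''.functor ≫ F''.functor.map (ε F'.functor)) ≫
          F''.functor.map (F'.functor.map (ε F.functor))
      simp)
    (by
      intro X Y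
      change μ F''.functor _ _ ≫ F''.functor.map (μ F'.functor _ _ ≫
          F'.functor.map (μ F.functor X Y)) =
        (μ F''.functor _ _ ≫ F''.functor.map (μ F'.functor _ _)) ≫
          F''.functor.map (F'.functor.map (μ F.functor X Y))
      simp)

/-- Isomorphism of monoidal functors: there is a monoidal natural isomorphism between them. -/
def Isomorphic {G G' : MonAbGpd.{u, v}} (F F' : G ⟶ G') : Prop :=
  ∃ e : F.functor ≅ F'.functor, NatTrans.IsMonoidal e.hom

/-- A monoidal functor is a monoidal equivalence if it has a quasi-inverse monoidal functor. -/
def IsEquivalence {G G' : MonAbGpd.{u, v}} (F : G ⟶ G') : Prop :=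
  ∃ F' : G' ⟶ G, Isomorphic (𝟙 G) (F ≫ F') ∧ Isomorphic (F' ≫ F) (𝟙 G')

/-- The relation of isomorphism on the monoidal functors with property `P`. -/
def isoSetoid {G G' : MonAbGpd.{u, v}} (P : (G ⟶ G') → Prop) : Setoid {F : G ⟶ G' // P F} where
  r F F' := Isomorphic F.1 F'.1
  iseqv :=
    { refl := fun _ => ⟨Iso.refl _, inferInstanceAs (NatTrans.IsMonoidal (𝟙 _))⟩
      symm := fun ⟨e, _⟩ => ⟨e.symm, inferInstanceAs (NatTrans.IsMonoidal e.inv)⟩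
      trans := fun ⟨e, _⟩ ⟨e', _⟩ =>
        ⟨e ≪≫ e', inferInstanceAs (NatTrans.IsMonoidal (e.hom ≫ e'.hom))⟩ }

end MonAbGpd

/-- The classifying functor `Cl : MonAbGpd ⥤ H³Mnd`, for a given choice `κ` of cleavages:
`G ↦ (M(G), (A(G), Θ(G)), [λ(G)])` and `F ↦ (p(F), q(F))`. -/
def classifyingFunctor (κ : ∀ G : MonAbGpd.{u, v}, Cleavage G.carrier) :
    MonAbGpd.{u, v} ⥤ H3Mnd.{u, v} where
  obj G :=
    { M := IsoClass G.carrier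
      A := (κ G).module
      c := DMod.H3.cls (κ G).cocycle }
  map {G G'} F :=
    { p := IsoClass.map F.functor
      q := (κ G).qHom (κ G') F.functor
      comm := (κ G).pull_cocycle (κ G') F.functor }
  map_id G := by
    refine H3Mnd.hom_ext ?_ ?_
    · ext a
      obtain ⟨X, rfl⟩ := a.exists_mk
      rfl
    · intro a x
      exact (κ G).tr_eq_of_sim (f := (κ G).qMap (κ G) (𝟭 G.carrier) (ofAut x)) (g := ofAut x) _
        ((κ G).qMap_sim _ _ _)
  map_comp {G G' G''} F F' := by
    refine H3Mnd.hom_ext ?_ ?_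
    · ext a
      obtain ⟨X, rfl⟩ := a.exists_mk
      rfl
    · intro a x
      refine (κ G'').tr_eq_of_sim
        (f := (κ G).qMap (κ G'') (F.functor ⋙ F'.functor) (ofAut x))
        (g := (κ G').qMap (κ G'') F'.functor ((κ G).qMap (κ G') F.functor (ofAut x))) _ ?_
      refine ((κ G).qMap_sim _ _ _).trans (Sim.trans ?_ ((κ G').qMap_sim _ _ _).symm)
      exact ((κ G).qMap_sim (κ G') F.functor (ofAut x)).symm.map F'.functor

end Leech

end

/-! The proof rests on two facts. First, in an abelian groupoid, automorphisms of one object that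
correspond under some isomorphism are equal (`Sim.eq`). So the maps `a_*`, `b^*` and `q_a` do not
depend on the isomorphisms used to define them, and another cleavage only changes the classifying
object by an isomorphism (`changeIso`). Second, a monoidal abelian groupoid is equivalent to a
skeletal one built from its 3-cocycle: the objects are the elements of the monoid, the automorphisms
of `a` form `A_a`, and the associator is the cocycle. The pentagon is the cocycle equation, and the
triangle is normalization. This groupoid realizes every class (`clIso`).

A monoidal functor with an invertible `Cl(F)` is bijective on isomorphism classes and on
automorphism groups. It is therefore an equivalence of categories, and its inverse is automatically
monoidal (`isEquivalence_iff_isIso`).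

Fix an arrow `(p, q)`. The condition on classes says that some normalized 2-cochain `φ` satisfies
`q_* λ = p^* λ' + ∂φ` (`Compatible`). Such a `φ` twists the isomorphisms `γ'` into the constraints
of a monoidal functor on the skeletal groupoid (`coreMonoidal`). Composing with an inverse of the
equivalence from the skeletal groupoid to `G` gives a functor on `G` (`exists_functor_iso`).
Conversely, every `F` over `(p, q)` yields such a `φ` (`exists_comparison`), and two functors are
isomorphic exactly when their cochains differ by a coboundary (`Comparison.isomorphic_iff`). The
compatible cochains form a coset of the 2-cocycles, so a base point identifies the isomorphism
classes of functors with `H²`. -/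

namespace Leech

/-! ### The monoidal abelian groupoid of a 3-cocycle -/

/-- Objects of the monoidal groupoid of a 3-cocycle: the elements of the monoid. -/
structure Model {M : Type u} [Monoid M] {A : DMod.{u, v} M} (m : A.Z3) : Type u where
  /-- the underlying element -/
  elt : M

namespace Model

variable {M : Type u} [Monoid M] {A : DMod.{u, v} M} {m : A.Z3}

/-- Morphisms `a ⟶ b`, which exist only for `a = b`, are the elements of `A_b`. -/
@[ext]
structure Hom (a b : Model m) : Type v where
  eq : a.elt = b.elt
  /-- the underlying element of the module -/
  val : A.at' b.elt

/-- The groups at propositionally equal elements are distinct types. Values are therefore stored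
over the target and moved by `tr`, the action of an identity arrow; functoriality of `A` then
replaces all reasoning about casts. -/
noncomputable instance : Groupoid.{v} (Model m) where
  Hom := Hom
  id _ := ⟨rfl, 0⟩
  comp f g := ⟨f.eq.trans g.eq, A.tr g.eq f.val + g.val⟩
  id_comp f := Hom.ext (by simp)
  comp_id f := Hom.ext (by simp [DMod.tr_rfl])
  assoc f g h := Hom.ext (by simp [DMod.tr, DMod.act_act, add_assoc])
  inv f := ⟨f.eq.symm, -A.tr f.eq.symm f.val⟩
  inv_comp f := Hom.ext (by simp [DMod.tr, DMod.act_act, DMod.act_one])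
  comp_inv f := Hom.ext (by simp [DMod.tr])

lemma hom_ext {a b : Model m} {f g : a ⟶ b} (h : f.val = g.val) : f = g := Hom.ext h

/-- The morphism given by an element of the module. -/
def homMk {a b : Model m} (h : a.elt = b.elt) (x : A.at' b.elt) : a ⟶ b := ⟨h, x⟩

@[simp] lemma homMk_val {a b : Model m} (h : a.elt = b.elt) (x : A.at' b.elt) :
    (homMk h x).val = x := rfl

@[simp] lemma id_val (a : Model m) : Hom.val (𝟙 a) = 0 := rfl

@[simp] lemma comp_val {a b c : Model m} (f : a ⟶ b) (g : b ⟶ c) :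
    (f ≫ g).val = A.tr g.eq f.val + g.val := rfl

lemma inv_val {a b : Model m} (f : a ⟶ b) :
    (inv f).val = -A.tr f.eq.symm f.val := by
  rw [← Groupoid.inv_eq_inv]
  rfl

instance : AbelianGroupoid (Model m) where
  comm f g := hom_ext (by simp [DMod.tr_rfl, add_comm])

/-- The isomorphism given by an element of the module. -/
def isoMk {a b : Model m} (h : a.elt = b.elt) (x : A.at' b.elt) : a ≅ b where
  hom := homMk h x
  inv := homMk h.symm (-A.tr h.symm x)
  hom_inv_id := hom_ext (by simp [DMod.tr])
  inv_hom_id := hom_ext (by simp [DMod.tr, DMod.act_act, DMod.act_one])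

/-- Unit constraints can be taken to be zero because the cocycle is normalized. -/
noncomputable instance : MonoidalCategoryStruct (Model m) where
  tensorObj a b := ⟨a.elt * b.elt⟩
  tensorUnit := ⟨1⟩
  whiskerLeft a _ _ f := homMk (congrArg (a.elt * ·) f.eq) (A.lstar a.elt rfl f.val)
  whiskerRight f b := homMk (congrArg (· * b.elt) f.eq) (A.rstar b.elt rfl f.val)
  tensorHom {_ a' _ b'} f g := homMk (congrArg₂ (· * ·) f.eq g.eq)
    (A.rstar b'.elt rfl f.val + A.lstar a'.elt rfl g.val)
  associator a b c := isoMk (mul_assoc _ _ _)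
    (A.tr (mul_assoc _ _ _) (m.1 a.elt b.elt c.elt))
  leftUnitor _ := isoMk (one_mul _) 0
  rightUnitor _ := isoMk (mul_one _) 0

@[simp] lemma tensor_elt (a b : Model m) : (a ⊗ b).elt = a.elt * b.elt := rfl
@[simp] lemma unit_elt : (𝟙_ (Model m)).elt = 1 := rfl

@[simp] lemma whiskerLeft_val (a : Model m) {b c : Model m} (f : b ⟶ c) :
    (a ◁ f).val = A.lstar a.elt rfl f.val := rfl

@[simp] lemma whiskerRight_val {b c : Model m} (f : b ⟶ c) (a : Model m) :
    (f ▷ a).val = A.rstar a.elt rfl f.val := rfl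

@[simp] lemma tensorHom_val {a a' b b' : Model m} (f : a ⟶ a') (g : b ⟶ b') :
    (f ⊗ₘ g).val = A.rstar b'.elt rfl f.val + A.lstar a'.elt rfl g.val := rfl

@[simp] lemma associator_hom_val (a b c : Model m) :
    (α_ a b c).hom.val = A.tr (mul_assoc _ _ _) (m.1 a.elt b.elt c.elt) := rfl

@[simp] lemma leftUnitor_hom_val (a : Model m) : (λ_ a).hom.val = 0 := rfl

@[simp] lemma rightUnitor_hom_val (a : Model m) : (ρ_ a).hom.val = 0 := rfl

noncomputable instance : MonoidalCategory (Model m) where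
  tensorHom_def {a₁ b₁ a₂ b₂} f g := hom_ext (by
    -- Splitting the target object turns its element into a free variable, so that the equality of
    -- elements can be eliminated.
    have h := g.eq
    obtain ⟨b₂⟩ := b₂
    dsimp at h
    subst h
    simp [DMod.tr, DMod.rstar, DMod.lstar, DMod.act_act])
  id_tensorHom_id a b := hom_ext (by simp)
  tensorHom_comp_tensorHom {a₁ b₁ c₁ a₂ b₂ c₂} f₁ f₂ g₁ g₂ := hom_ext (by
    have h1 := g₁.eq
    have h2 := g₂.eq
    obtain ⟨c₁⟩ := c₁
    obtain ⟨c₂⟩ := c₂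
    dsimp at h1 h2
    subst h1 h2
    simp [DMod.tr, DMod.rstar, DMod.lstar, DMod.act_act]
    abel)
  whiskerLeft_id a b := hom_ext (by simp)
  id_whiskerRight a b := hom_ext (by simp)
  associator_naturality {a₁ a₂ a₃ b₁ b₂ b₃} f₁ f₂ f₃ := hom_ext (by
    have h1 := f₁.eq
    have h2 := f₂.eq
    have h3 := f₃.eq
    obtain ⟨b₁⟩ := b₁
    obtain ⟨b₂⟩ := b₂
    obtain ⟨b₃⟩ := b₃
    dsimp at h1 h2 h3
    subst h1 h2 h3
    simp [DMod.tr, DMod.rstar, DMod.lstar, DMod.act_act]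
    abel)
  leftUnitor_naturality f := hom_ext (by
    simp [DMod.tr, DMod.lstar, DMod.act_act, DMod.act_one])
  rightUnitor_naturality f := hom_ext (by
    simp [DMod.tr, DMod.rstar, DMod.act_act, DMod.act_one])
  pentagon a b c d := hom_ext (by
    have h : A.d3 m.1 = 0 := m.2.2
    have h := congrFun (congrFun (congrFun (congrFun h a.elt) b.elt) c.elt) d.elt
    -- The cocycle identity lives over `((ab)c)d`, whereas the two sides of the pentagon end at
    -- `a(b(cd))`.
    have h := congrArg (A.tr (show a.elt * b.elt * c.elt * d.elt = a.elt * (b.elt * (c.elt * d.elt))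
      by simp only [mul_assoc])) h
    simp only [DMod.d3, AddMonoidHom.mk'_apply, DMod.tr, DMod.rstar, DMod.lstar, DMod.act_act,
      map_add, map_sub, Pi.zero_apply, map_zero, mul_one, one_mul] at h
    simp [DMod.tr, DMod.rstar, DMod.lstar, DMod.act_act]
    rw [← sub_eq_zero, ← h]
    abel)
  triangle a b := hom_ext (by
    -- Only normalization in the middle variable enters here.
    simp [(m.2.1 a.elt b.elt).2.1])

end Model

lemma DMod.act_eq_self {M : Type u} [Monoid M] (A : DMod.{u, v} M) {l r x : M} (hl : l = 1)
    (hr : r = 1) (h : l * x * r = x) (f : A.at' x) : A.act l r h f = f := by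
  subst hl hr
  exact A.act_one _ _

namespace Model

variable {M : Type u} [Monoid M] {A : DMod.{u, v} M} {m : A.Z3}

/-- The element of the monoid attached to an isomorphism class. -/
noncomputable def classElt (a : IsoClass (Model m)) : M :=
  Quotient.lift (s := isIsomorphicSetoid (Model m)) Model.elt (fun _ _ ⟨e⟩ => e.hom.eq) a

lemma mk_classElt (a : IsoClass (Model m)) : IsoClass.mk (⟨classElt a⟩ : Model m) = a := by
  obtain ⟨X, rfl⟩ := a.exists_mk
  rfl

@[simp] lemma classElt_mul (a b : IsoClass (Model m)) :
    classElt (a * b) = classElt a * classElt b := by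
  obtain ⟨X, rfl⟩ := a.exists_mk
  obtain ⟨Y, rfl⟩ := b.exists_mk
  rfl

variable (m) in
/-- The isomorphism of the monoid with the monoid of isomorphism classes. -/
noncomputable def classEquiv : M ≃* IsoClass (Model m) where
  toFun a := IsoClass.mk ⟨a⟩
  invFun := classElt
  left_inv _ := rfl
  right_inv := mk_classElt
  map_mul' _ _ := rfl

@[simp] lemma eqToHom_val {a b : Model m} (h : a = b) : (eqToHom h).val = 0 := by
  subst h
  rfl

lemma unit_left_val {a b : Model m} (h : a = 𝟙_ (Model m)) :
    (eqToHom h ▷ b ≫ (λ_ b).hom).val = 0 := by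
  simp

lemma unit_right_val {a b : Model m} (h : b = 𝟙_ (Model m)) :
    (a ◁ eqToHom h ≫ (ρ_ a).hom).val = 0 := by
  simp

/-- Conjugation by a morphism of value zero is mere transport. Hence a cleavage with zero values
computes the original action, and below, the original cocycle. -/
lemma conj_whiskerLeft_val {a x y : Model m} (g : a ⊗ x ⟶ y) (hg : g.val = 0) (f : x ⟶ x) :
    (inv g ≫ a ◁ f ≫ g).val = A.lstar a.elt g.eq f.val := by
  simp [inv_val, hg, DMod.tr, DMod.lstar, DMod.act_act]

lemma conj_whiskerRight_val {a x y : Model m} (g : x ⊗ a ⟶ y) (hg : g.val = 0) (f : x ⟶ x) :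
    (inv g ≫ f ▷ a ≫ g).val = A.rstar a.elt g.eq f.val := by
  simp [inv_val, hg, DMod.tr, DMod.rstar, DMod.act_act]

lemma associator_conj_val {a b c p q x : Model m} (f : a ⊗ b ⟶ p) (g : p ⊗ c ⟶ x)
    (f' : b ⊗ c ⟶ q) (g' : a ⊗ q ⟶ x) (hf : f.val = 0) (hg : g.val = 0) (hf' : f'.val = 0)
    (hg' : g'.val = 0) :
    (inv (f ▷ c ≫ g) ≫ (α_ a b c).hom ≫ a ◁ f' ≫ g').val =
      A.tr (show a.elt * b.elt * c.elt = x.elt from (f ▷ c ≫ g).eq)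
        (m.1 a.elt b.elt c.elt) := by
  simp [inv_val, hf, hg, hf', hg', DMod.tr, DMod.act_act]

variable (m) in
/-- The cleavage for which the morphisms `γ` are identities. -/
noncomputable def cleavage : Cleavage (Model m) where
  obj a := ⟨classElt a⟩
  mk_obj := mk_classElt
  obj_one := rfl
  Γ _ _ h := homMk (congrArg classElt h) 0
  Γ_obj _ := rfl
  γ {a b c} h := homMk (show classElt a * classElt b = classElt c by simp [← h]) 0
  γ_one_left _ := hom_ext (unit_left_val _).symm
  γ_one_right _ := hom_ext (unit_right_val _).symm

lemma cleavage_lam_val (a b c : IsoClass (Model m)) {x : IsoClass (Model m)} (h : a * b * c = x) :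
    ((cleavage m).lam a b c h).val =
      A.tr (show classElt a * classElt b * classElt c = classElt x by simp [← h])
        (m.1 (classElt a) (classElt b) (classElt c)) :=
  associator_conj_val _ _ _ _ rfl rfl rfl rfl

lemma cleavage_act_val {l r x y : IsoClass (Model m)} (h : l * x * r = y)
    (f : (cleavage m).module.at' x) :
    (ofAut (X := (cleavage m).obj y) ((cleavage m).module.act l r h f)).val =
      A.act (x := classElt x) (y := classElt y) (classElt l) (classElt r) (by simp [← h])
        (ofAut (X := (cleavage m).obj x) f).val := by
  refine (conj_whiskerLeft_val ((cleavage m).γ _) rfl _).trans ?_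
  refine (congrArg _ (conj_whiskerRight_val ((cleavage m).γ _) rfl (ofAut f))).trans ?_
  refine (DMod.act_act A _ _ _).trans ?_
  congr 2
  · exact mul_one _
  · exact mul_one _

/-- Endomorphisms of an object are the elements of the group attached to it. -/
noncomputable def autEquiv (a : Model m) : autGrp a ≃+ A.at' a.elt where
  toFun f := (ofAut f).val
  invFun x := toAut (homMk rfl x)
  left_inv _ := rfl
  right_inv _ := rfl
  map_add' f g := by
    rw [ofAut_add, comp_val, DMod.tr_rfl]

end Model

/-- The monoidal abelian groupoid of a 3-cocycle, as an object of `MonAbGpd`. -/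
noncomputable def model {M : Type u} [Monoid M] {A : DMod.{u, v} M} (m : A.Z3) : MonAbGpd.{u, v} :=
  ⟨Model m⟩

/-! ### Independence of the choice of cleavage. -/

namespace Cleavage

variable {G : Type u} [Groupoid.{v} G] [MonoidalCategory G] [AbelianGroupoid G]

/-- The object of `H³Mnd` given by a cleavage. -/
noncomputable def toH3Mnd (κ : Cleavage G) : H3Mnd.{u, v} :=
  ⟨IsoClass G, κ.module, DMod.H3.cls κ.cocycle⟩

/-- Different cleavages give isomorphic objects of `H³Mnd`. -/
noncomputable def changeHom (κ κ' : Cleavage G) : κ.toH3Mnd ⟶ κ'.toH3Mnd :=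
  H3Mnd.Hom.mk (S := κ.toH3Mnd) (T := κ'.toH3Mnd) (IsoClass.map (𝟭 G)) (κ.qHom κ' (𝟭 G))
    (κ.pull_cocycle κ' (𝟭 G))

/-- The composite replaces an automorphism by a conjugate of it, which is the same element of the
abelian group. -/
lemma changeHom_comp (κ κ' : Cleavage G) : κ.changeHom κ' ≫ κ'.changeHom κ = 𝟙 _ := by
  have hp : (IsoClass.map (𝟭 G)).comp (IsoClass.map (𝟭 G)) = MonoidHom.id (IsoClass G) := by
    ext a
    obtain ⟨X, rfl⟩ := a.exists_mk
    rfl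
  refine H3Mnd.hom_ext hp ?_
  intro a x
  refine κ.tr_eq_of_sim
    (f := κ'.qMap κ (𝟭 G) (κ.qMap κ' (𝟭 G) (ofAut x))) (g := ofAut x) _ ?_
  exact (κ'.qMap_sim _ _ _).trans (κ.qMap_sim κ' (𝟭 G) (ofAut x))

/-- Different cleavages give isomorphic objects of `H³Mnd`. -/
noncomputable def changeIso (κ κ' : Cleavage G) : κ.toH3Mnd ≅ κ'.toH3Mnd where
  hom := κ.changeHom κ'
  inv := κ'.changeHom κ
  hom_inv_id := κ.changeHom_comp κ'
  inv_hom_id := κ'.changeHom_comp κ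

end Cleavage

/-! ### The invariants of the groupoid of a cocycle. -/

namespace Model

variable {M : Type u} [Monoid M] {A : DMod.{u, v} M} (m : A.Z3)

/-- The morphism from a 3-cocycle to the invariants of its monoidal groupoid. -/
noncomputable def toCl :
    (⟨M, A, DMod.H3.cls m⟩ : H3Mnd.{u, v}) ⟶ (cleavage m).toH3Mnd :=
  H3Mnd.Hom.mk (S := ⟨M, A, DMod.H3.cls m⟩) (T := (cleavage m).toH3Mnd)
    (classEquiv m).toMonoidHom
    { app := fun a => AddCommGrpCat.ofHom (X := A.at' a.elt) (Y := autGrp (⟨a.elt⟩ : Model m))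
        (autEquiv (m := m) ⟨a.elt⟩).symm.toAddMonoidHom
      naturality := by
        intro x y t
        ext f
        refine hom_ext ?_
        -- `classElt` of the class of an element reduces to that element, so the formula for the
        -- action applies without transport.
        exact (cleavage_act_val (m := m) (l := classEquiv m t.l) (r := classEquiv m t.r)
          (x := classEquiv m x.elt) (y := classEquiv m y.elt) (by simp [← t.eq])
          (toAut (homMk rfl f))).symm }
    (by
      -- The two cocycles agree on the nose; no coboundary is needed.
      refine congrArg DMod.H3.cls ?_
      ext a b c
      refine hom_ext ?_
      refine (cleavage_act_val (m := m) _ _).trans ?_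
      refine (congrArg _ (cleavage_lam_val (m := m) _ _ _ rfl)).trans ?_
      refine (DMod.act_act A _ _ _).trans ?_
      exact A.act_eq_self (mul_one _) (mul_one _) _ _)

/-- The morphism from the invariants of the monoidal groupoid of a 3-cocycle to the cocycle. -/
noncomputable def ofCl :
    (cleavage m).toH3Mnd ⟶ (⟨M, A, DMod.H3.cls m⟩ : H3Mnd.{u, v}) :=
  H3Mnd.Hom.mk (S := (cleavage m).toH3Mnd) (T := ⟨M, A, DMod.H3.cls m⟩)
    (classEquiv m).symm.toMonoidHom
    { app := fun a => AddCommGrpCat.ofHom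
        (X := autGrp ((cleavage m).obj a.elt)) (Y := A.at' (classElt a.elt))
        (autEquiv ((cleavage m).obj a.elt)).toAddMonoidHom
      naturality := by
        intro x y t
        ext f
        exact cleavage_act_val (m := m) t.eq f }
    (by
      refine congrArg DMod.H3.cls ?_
      ext a b c
      exact (cleavage_lam_val (m := m) a b c rfl).symm)

/-- A 3-cocycle is recovered from its monoidal groupoid. -/
noncomputable def clIso :
    (⟨M, A, DMod.H3.cls m⟩ : H3Mnd.{u, v}) ≅ (cleavage m).toH3Mnd where
  hom := toCl m
  inv := ofCl m
  hom_inv_id := by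
    refine H3Mnd.hom_ext rfl ?_
    intro a x
    exact DMod.tr_rfl _ _ _
  inv_hom_id := by
    refine H3Mnd.hom_ext ?_ ?_
    · ext a
      exact mk_classElt a
    · intro a x
      refine (cleavage m).tr_eq_of_sim (x := classEquiv m (classElt a)) (y := a)
        (f := ofAut x) (g := ofAut x) _ ?_
      exact Sim.refl _

end Model

theorem exists_classifyingFunctor_iso (κ : ∀ G : MonAbGpd.{u, v}, Cleavage G.carrier)
    (S : H3Mnd.{u, v}) : ∃ G : MonAbGpd.{u, v}, Nonempty ((classifyingFunctor κ).obj G ≅ S) := by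
  obtain ⟨M, A, c⟩ := S
  obtain ⟨m, rfl⟩ := DMod.H3.cls_surj c
  refine ⟨model m, ⟨?_⟩⟩
  -- The prescribed cleavage of the model is arbitrary, so it is first exchanged for the one with
  -- zero values.
  exact ((Model.cleavage m).changeIso (κ (model m))).symm ≪≫ (Model.clIso m).symm

/-! ### Monoidal equivalences -/

/-- The inverse of a monoidal functor is a monoidal inverse. -/
lemma isMonoidal_inverseMonoidal {C : Type u} [Category.{v} C] [MonoidalCategory C] {D : Type u'}
    [Category.{v'} D] [MonoidalCategory D] (e : C ≌ D) [e.functor.Monoidal] :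
    letI := e.inverseMonoidal
    e.IsMonoidal := by
  let := e.inverseMonoidal
  -- The structure on the inverse is defined as the mate of the one on `e.functor`, which is the
  -- condition to be checked.
  exact ⟨rfl, fun _ _ => rfl⟩

namespace MonAbGpd

/-- The constraints of `F` transfer to the inverse functor, and the unit and counit are then
monoidal. So only the underlying functor has to be examined. -/
lemma isEquivalence_of_functor {G G' : MonAbGpd.{u, v}} (F : G ⟶ G')
    (h : F.functor.IsEquivalence) : IsEquivalence F := by
  let e := F.functor.asEquivalence
  let : e.functor.Monoidal := F.monoidal
  let := e.inverseMonoidal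
  have : e.IsMonoidal := isMonoidal_inverseMonoidal e
  exact ⟨⟨e.inverse⟩, ⟨e.unitIso, inferInstanceAs (NatTrans.IsMonoidal e.unit)⟩,
    ⟨e.counitIso, inferInstanceAs (NatTrans.IsMonoidal e.counit)⟩⟩

end MonAbGpd

variable (κ : ∀ G : MonAbGpd.{u, v}, Cleavage G.carrier)

/-- The components of the isomorphism make `F(f)` and `F'(f)` correspond to each other, and
corresponding automorphisms induce the same element. -/
lemma classifyingFunctor_map_eq_of_isomorphic {G G' : MonAbGpd.{u, v}} {F F' : G ⟶ G'}
    (h : MonAbGpd.Isomorphic F F') :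
    (classifyingFunctor κ).map F = (classifyingFunctor κ).map F' := by
  obtain ⟨e, _⟩ := h
  refine H3Mnd.hom_ext ?_ ?_
  · ext a
    obtain ⟨X, rfl⟩ := a.exists_mk
    exact IsoClass.mk_eq_mk.2 ⟨e.app X⟩
  · intro a x
    refine (κ G').tr_eq_of_sim (f := (κ G).qMap (κ G') F.functor (ofAut x))
      (g := (κ G).qMap (κ G') F'.functor (ofAut x)) _ ?_
    refine ((κ G).qMap_sim _ _ _).trans (Sim.trans ?_ ((κ G).qMap_sim _ _ _).symm)
    exact ⟨e.hom.app _, e.hom.naturality _⟩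

lemma isIso_classifyingFunctor_map {G G' : MonAbGpd.{u, v}} {F : G ⟶ G'}
    (h : MonAbGpd.IsEquivalence F) : IsIso ((classifyingFunctor κ).map F) := by
  obtain ⟨F', h1, h2⟩ := h
  refine ⟨(classifyingFunctor κ).map F', ?_, ?_⟩
  · rw [← Functor.map_comp, ← classifyingFunctor_map_eq_of_isomorphic κ h1, CategoryTheory.Functor.map_id]
  · rw [← Functor.map_comp, classifyingFunctor_map_eq_of_isomorphic κ h2, CategoryTheory.Functor.map_id]

lemma H3Mnd.bijective_p_of_isIso {S T : H3Mnd.{u, v}} (f : S ⟶ T) [IsIso f] :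
    Function.Bijective f.p := by
  have h1 := congrArg H3Mnd.Hom.p (IsIso.hom_inv_id f)
  have h2 := congrArg H3Mnd.Hom.p (IsIso.inv_hom_id f)
  exact Function.bijective_iff_has_inverse.2 ⟨(inv f).p, fun a => DFunLike.congr_fun h1 a,
    fun a => DFunLike.congr_fun h2 a⟩

/-- Equal arrows have module components in groups indexed by `f.p a` and `g.p a`, so these can be
compared only after transport. -/
lemma H3Mnd.tr_comp'_of_eq {S T : H3Mnd.{u, v}} {f g : S ⟶ T} (h : f = g) (a : S.M)
    (x : S.A.at' a) :
    T.A.tr (by rw [h]) (DMod.comp' f.q a x : T.A.at' (f.p a)) = DMod.comp' g.q a x := by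
  subst h
  exact DMod.tr_rfl _ _ _

lemma H3Mnd.comp'_tr {S T : H3Mnd.{u, v}} (f : S ⟶ T) {a b : S.M} (h : a = b)
    (x : S.A.at' a) : (DMod.comp' f.q b (S.A.tr h x) : T.A.at' (f.p b)) =
      T.A.tr (congrArg f.p h) (DMod.comp' f.q a x : T.A.at' (f.p a)) := by
  subst h
  exact (congrArg _ (S.A.tr_rfl _ x)).trans (T.A.tr_rfl _ _).symm

lemma H3Mnd.bijective_q_of_isIso {S T : H3Mnd.{u, v}} (f : S ⟶ T) [IsIso f] (a : S.M) :
    Function.Bijective (DMod.comp' f.q a : S.A.at' a → T.A.at' (f.p a)) := by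
  have h1 := IsIso.hom_inv_id f
  have h2 := IsIso.inv_hom_id f
  have hp := DFunLike.congr_fun (congrArg H3Mnd.Hom.p h1) a
  constructor
  · intro x y h
    refine (H3Mnd.tr_comp'_of_eq h1 a x).symm.trans (Eq.trans ?_ (H3Mnd.tr_comp'_of_eq h1 a y))
    refine congrArg _ ?_
    exact congrArg (DMod.comp' (inv f).q (f.p a)) h
  · intro y
    -- The inverse arrow lands over `(inv f).p (f.p a)`, which is only propositionally `a`.
    refine ⟨S.A.tr hp (DMod.comp' (inv f).q (f.p a) y), ?_⟩
    have e := H3Mnd.tr_comp'_of_eq h2 (f.p a) y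
    refine Eq.trans ?_ e
    exact H3Mnd.comp'_tr f hp _

/-- Conjugation by `Γ_X` carries bijectivity on automorphisms from the representatives to all
objects. In a groupoid this gives faithfulness. Together with injectivity on isomorphism classes it
gives fullness, and surjectivity on classes is essential surjectivity. -/
lemma isEquivalence_functor_of_bijective {G : Type u} [Groupoid.{v} G] [MonoidalCategory G]
    [AbelianGroupoid G] {G' : Type u'} [Groupoid.{v} G'] [MonoidalCategory G'] [AbelianGroupoid G']
    (κ : Cleavage G) (F : G ⥤ G') [F.Monoidal] (hp : Function.Bijective (IsoClass.map F))
    (hF : ∀ a : IsoClass G, Function.Bijective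
      (fun f : κ.obj a ⟶ κ.obj a => F.map f)) : F.IsEquivalence := by
  have hX : ∀ X : G, Function.Bijective (fun f : X ⟶ X => F.map f) := by
    intro X
    let t := κ.Γ X rfl
    constructor
    · intro f g h
      have h : F.map f = F.map g := h
      have : inv t ≫ f ≫ t = inv t ≫ g ≫ t := (hF _).1 (by simp [h])
      rwa [cancel_epi, cancel_mono] at this
    · intro g
      obtain ⟨f, hf⟩ := (hF _).2 (F.map (inv t) ≫ g ≫ F.map t)
      have hf : F.map f = _ := hf
      exact ⟨t ≫ f ≫ inv t, by simp [hf]⟩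
  have h1 : F.Faithful := ⟨by
    intro X Y f g h
    have : f ≫ inv g = 𝟙 X := (hX X).1 (by simp [h])
    rwa [IsIso.comp_inv_eq, Category.id_comp] at this⟩
  have h2 : F.Full := ⟨by
    intro X Y g
    -- The arrow `g` shows that `F X` and `F Y` are isomorphic, hence so are `X` and `Y`; an
    -- automorphism of `X` then corrects `e` to a preimage of `g`.
    obtain ⟨e⟩ := IsoClass.mk_eq_mk.1 (hp.1 (show IsoClass.map F (IsoClass.mk X) =
      IsoClass.map F (IsoClass.mk Y) from IsoClass.mk_eq_mk.2 ⟨asIso g⟩))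
    obtain ⟨f, hf⟩ := (hX X).2 (g ≫ inv (F.map e.hom))
    have hf : F.map f = _ := hf
    exact ⟨f ≫ e.hom, by simp [hf]⟩⟩
  have h3 : F.EssSurj := ⟨by
    intro Y
    obtain ⟨a, ha⟩ := hp.2 (IsoClass.mk Y)
    obtain ⟨X, rfl⟩ := a.exists_mk
    exact ⟨X, IsoClass.mk_eq_mk.1 ha⟩⟩
  exact {}

theorem isEquivalence_iff_isIso {G G' : MonAbGpd.{u, v}} (F : G ⟶ G') :
    MonAbGpd.IsEquivalence F ↔ IsIso ((classifyingFunctor κ).map F) := by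
  refine ⟨isIso_classifyingFunctor_map κ, fun h => ?_⟩
  refine MonAbGpd.isEquivalence_of_functor F ?_
  refine isEquivalence_functor_of_bijective (κ G) F.functor
    (H3Mnd.bijective_p_of_isIso ((classifyingFunctor κ).map F)) ?_
  intro (a : IsoClass G.carrier)
  have hq := H3Mnd.bijective_q_of_isIso ((classifyingFunctor κ).map F) a
  -- The map `q_a` is `F` on automorphisms followed by conjugation with `t`, so bijectivity passes
  -- from one to the other.
  let t : F.functor.obj ((κ G).obj a) ⟶ (κ G').obj (IsoClass.map F.functor a) :=
    (κ G').Γ _ ((κ G).mk_map_obj F.functor a)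
  constructor
  · intro f g h
    refine hq.1 (a₁ := toAut f) (a₂ := toAut g) ?_
    exact congrArg (fun k => toAut (inv t ≫ k ≫ t)) h
  · intro g
    obtain ⟨f, hf⟩ := hq.2
      (toAut (X := (κ G').obj (IsoClass.map F.functor a)) (inv t ≫ g ≫ t))
    refine ⟨ofAut f, ?_⟩
    have hf : inv t ≫ F.functor.map (ofAut f) ≫ t = inv t ≫ g ≫ t := hf
    rwa [cancel_epi, cancel_mono] at hf

/-! ### Compatible 2-cochains -/

section Compatible

variable {M : Type w} [Monoid M] {G' : Type u'} [Groupoid.{v} G'] [MonoidalCategory G']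
  [AbelianGroupoid G'] {κ' : Cleavage G'} {p : M →* IsoClass G'}

/-- The automorphism of `X_{p(x)}`, where `x = a b`, which is given by a family of elements. -/
noncomputable def famHom (φ : (DMod.pull p κ'.module).Fam2) (a b : M) {x : M} (h : a * b = x) :
    κ'.obj (p x) ⟶ κ'.obj (p x) :=
  ofAut (X := κ'.obj (p x)) ((DMod.pull p κ'.module).tr h (φ a b))

lemma famHom_rfl (φ : (DMod.pull p κ'.module).Fam2) (a b : M) :
    famHom φ a b rfl = ofAut (X := κ'.obj (p (a * b))) (φ a b) :=
  congrArg ofAut (DMod.tr_rfl _ _ _)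

lemma toAut_famHom (φ : (DMod.pull p κ'.module).Fam2) (a b : M) {x : M} (h : a * b = x) :
    toAut (famHom φ a b h) = (DMod.pull p κ'.module).tr h (φ a b) := rfl

lemma famHom_eqToHom (φ : (DMod.pull p κ'.module).Fam2) (a b : M) {x y : M} (h : a * b = x)
    (e : x = y) : famHom φ a b h ≫ eqToHom (by rw [e]) =
      eqToHom (by rw [e]) ≫ famHom φ a b (h.trans e) := by
  subst e
  simp

omit [AbelianGroupoid G'] in
lemma Cleavage.γ_eqToHom (κ : Cleavage G') {a b x y : IsoClass G'} (h : a * b = x) (e : x = y) :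
    κ.γ h ≫ eqToHom (by rw [e]) = κ.γ (h.trans e) := by
  subst e
  simp

lemma famHom_one_left {φ : (DMod.pull p κ'.module).Fam2} (hφ : φ ∈ DMod.C2 _) (a : M) {x : M}
    (h : 1 * a = x) : famHom φ 1 a h = 𝟙 _ := by
  refine toAut_inj ?_
  rw [toAut_famHom, (hφ a).1, map_zero]
  rfl

lemma famHom_one_right {φ : (DMod.pull p κ'.module).Fam2} (hφ : φ ∈ DMod.C2 _) (a : M) {x : M}
    (h : a * 1 = x) : famHom φ a 1 h = 𝟙 _ := by
  refine toAut_inj ?_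
  rw [toAut_famHom, (hφ a).2, map_zero]
  rfl

variable {A : DMod.{w, v} M}

/-- The automorphism `q_a(x)`. -/
noncomputable def qHomAut (q : A ⟶ DMod.pull p κ'.module) {a : M} (x : A.at' a) :
    κ'.obj (p a) ⟶ κ'.obj (p a) :=
  ofAut (X := κ'.obj (p a)) (DMod.comp' q a x)

lemma qHomAut_add (q : A ⟶ DMod.pull p κ'.module) {a : M} (x y : A.at' a) :
    qHomAut q (x + y) = qHomAut q x ≫ qHomAut q y :=
  congrArg ofAut (map_add (DMod.comp' q a) x y)

lemma qHomAut_zero (q : A ⟶ DMod.pull p κ'.module) (a : M) :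
    qHomAut q (0 : A.at' a) = 𝟙 _ :=
  congrArg ofAut (map_zero (DMod.comp' q a))

lemma qHomAut_lstar (q : A ⟶ DMod.pull p κ'.module) (a : M) {b c : M} (h : a * b = c)
    (x : A.at' b) : qHomAut q (A.lstar a h x) =
      κ'.lst (p a) (by rw [← map_mul, h]) (qHomAut q x) := by
  refine toAut_inj ?_
  refine (DMod.comp'_act q _ _).trans ?_
  refine (DMod.pull_lstar p κ'.module h (by rw [← map_mul, h]) _).trans ?_
  exact κ'.lstar_toAut _ _ _

lemma qHomAut_rstar (q : A ⟶ DMod.pull p κ'.module) (a : M) {b c : M} (h : b * a = c)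
    (x : A.at' b) : qHomAut q (A.rstar a h x) =
      κ'.rst (p a) (by rw [← map_mul, h]) (qHomAut q x) := by
  refine toAut_inj ?_
  refine (DMod.comp'_act q _ _).trans ?_
  refine (DMod.pull_rstar p κ'.module h (by rw [← map_mul, h]) _).trans ?_
  exact κ'.rstar_toAut _ _ _

lemma qHomAut_tr (q : A ⟶ DMod.pull p κ'.module) {a b : M} (h : a = b) (x : A.at' a) :
    eqToHom (by rw [h]) ≫ qHomAut q (A.tr h x) = qHomAut q x ≫ eqToHom (by rw [h]) := by
  subst h
  simp [DMod.tr_rfl]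

/-- The normalized 2-cochains `φ` with `q_* m = p^* λ(G') + ∂φ`. -/
def Compatible (m : A.Z3) (q : A ⟶ DMod.pull p κ'.module)
    (φ : (DMod.pull p κ'.module).Fam2) : Prop :=
  φ ∈ (DMod.pull p κ'.module).C2 ∧
    (DMod.Z3.push q m : (DMod.pull p κ'.module).Fam3) =
      DMod.Z3.pull p κ'.module κ'.cocycle + (DMod.pull p κ'.module).d2 φ

/-- The additive cochain equation becomes an equation of composites in `G'`, the form in which it
meets the associativity axiom of a monoidal functor. -/
lemma push_eq_pull_add_iff (m : A.Z3) (q : A ⟶ DMod.pull p κ'.module)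
    (φ : (DMod.pull p κ'.module).Fam2) :
    (DMod.Z3.push q m : (DMod.pull p κ'.module).Fam3) =
      DMod.Z3.pull p κ'.module κ'.cocycle + (DMod.pull p κ'.module).d2 φ ↔
    ∀ a b c : M, κ'.lam (p a) (p b) (p c) (x := p (a * b * c)) (by simp) ≫
        κ'.lst (p a) (by simp [mul_assoc]) (famHom φ b c rfl) ≫
          famHom φ a (b * c) (mul_assoc a b c).symm =
      κ'.rst (p c) (map_mul _ _ _).symm (famHom φ a b rfl) ≫ famHom φ (a * b) c rfl ≫
        qHomAut q (m.1 a b c) := by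
  simp only [funext_iff]
  refine forall_congr' fun a => forall_congr' fun b => forall_congr' fun c => ?_
  -- Here `l` is the term of `λ'`, and `p1`, `p2`, `p3`, `p4` are the four terms of `∂φ` in order;
  -- the two negative ones change sides.
  have key : ∀ {l p1 p2 p3 p4 m p1' p2' l' p4' : autGrp (κ'.obj (p (a * b * c)))},
      l = l' → p1 = p1' → p2 = p2' → p4 = p4' →
      (m = l + (p1 - p2 + p3 - p4) ↔ l' + (p1' + p3) = p4' + (p2' + m)) := by
    rintro l p1 p2 p3 p4 m _ _ _ _ rfl rfl rfl rfl
    constructor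
    · rintro rfl
      abel
    · intro h
      have : m = (p4 + (p2 + m)) - p4 - p2 := by abel
      rw [this, ← h]
      abel
  refine key ?_ ?_ ?_ ?_
  · exact κ'.tr_lam (p a) (p b) (p c) rfl (by simp)
  · refine (DMod.pull_lstar p κ'.module _ (by simp [mul_assoc]) _).trans ?_
    refine Eq.trans ?_ (κ'.lstar_toAut _ _ _)
    exact congrArg _ (congrArg toAut (famHom_rfl φ b c).symm)
  · exact congrArg toAut (famHom_rfl φ (a * b) c).symm
  · refine (DMod.pull_rstar p κ'.module _ (by simp) _).trans ?_
    refine Eq.trans ?_ (κ'.rstar_toAut _ _ _)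
    exact congrArg _ (congrArg toAut (famHom_rfl φ a b).symm)

/-- Commutativity of the automorphism groups is what keeps `γ'` natural after it is twisted by `φ`.
-/
lemma γ_famHom_lst (φ : (DMod.pull p κ'.module).Fam2) (a b : M) {x : M} (h : a * b = x)
    (h' : p a * p b = p x) (f : κ'.obj (p b) ⟶ κ'.obj (p b)) :
    κ'.obj (p a) ◁ f ≫ κ'.γ h' ≫ famHom φ a b h =
      (κ'.γ h' ≫ famHom φ a b h) ≫ κ'.lst (p a) h' f := by
  rw [Category.assoc, AbelianGroupoid.comm (famHom φ a b h), reassoc_of% (κ'.γ_lst (p a) h' f)]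

lemma γ_famHom_rst (φ : (DMod.pull p κ'.module).Fam2) (a b : M) {x : M} (h : a * b = x)
    (h' : p a * p b = p x) (f : κ'.obj (p a) ⟶ κ'.obj (p a)) :
    f ▷ κ'.obj (p b) ≫ κ'.γ h' ≫ famHom φ a b h =
      (κ'.γ h' ≫ famHom φ a b h) ≫ κ'.rst (p b) h' f := by
  rw [Category.assoc, AbelianGroupoid.comm (famHom φ a b h), reassoc_of% (κ'.γ_rst (p b) h' f)]

/-- Once each `φ` is moved past `γ'` by the definition of `a_*` and `c^*`, and `λ'` absorbs the
associator of `G'`, the axiom is the compatibility equation at `(a, b, c)`. -/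
lemma Compatible.associativity {m : A.Z3} {q : A ⟶ DMod.pull p κ'.module}
    {φ : (DMod.pull p κ'.module).Fam2} (hφ : Compatible m q φ) (a b c : M) :
    (κ'.γ (map_mul p a b).symm ≫ famHom φ a b rfl) ▷ κ'.obj (p c) ≫
      (κ'.γ (map_mul p (a * b) c).symm ≫ famHom φ (a * b) c rfl) ≫
        eqToHom (by rw [mul_assoc]) ≫
          qHomAut q (A.tr (mul_assoc a b c) (m.1 a b c)) =
      (α_ (κ'.obj (p a)) (κ'.obj (p b)) (κ'.obj (p c))).hom ≫
        κ'.obj (p a) ◁ (κ'.γ (map_mul p b c).symm ≫ famHom φ b c rfl) ≫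
          κ'.γ (map_mul p a (b * c)).symm ≫ famHom φ a (b * c) rfl := by
  have key := (push_eq_pull_add_iff m q φ).1 hφ.2 a b c
  have h1 : p a * p (b * c) = p (a * b * c) := by simp [mul_assoc]
  -- Everything is brought to the object over `(ab)c`, where the compatibility equation lives.
  rw [← κ'.γ_eqToHom h1 (congrArg p (mul_assoc a b c)), Category.assoc,
    Category.assoc (κ'.γ h1),
    ← famHom_eqToHom φ a (b * c) (mul_assoc a b c).symm (mul_assoc a b c), qHomAut_tr]
  have e1 := κ'.γ_rst (p c) (map_mul p (a * b) c).symm (famHom φ a b rfl)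
  have e2 := κ'.γ_lst (p a) h1 (famHom φ b c rfl)
  have e3 := κ'.γ_lam (p a) (p b) (p c) (map_mul p a b).symm (map_mul p b c).symm
    (map_mul p (a * b) c).symm h1 (by simp)
  rw [comp_whiskerRight, MonoidalCategory.whiskerLeft_comp]
  simp only [Category.assoc]
  rw [← reassoc_of% e1, ← reassoc_of% e2, ← reassoc_of% e3]
  rw [← reassoc_of% key]

/-- Normalization of `φ` removes the twist here, leaving the normalized `γ'`, which is the unit
constraint. -/
lemma Compatible.left_unitality {m : A.Z3} {q : A ⟶ DMod.pull p κ'.module}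
    {φ : (DMod.pull p κ'.module).Fam2} (hφ : Compatible m q φ) (a : M) :
    (λ_ (κ'.obj (p a))).hom = eqToHom (by rw [map_one, κ'.obj_one]) ▷ κ'.obj (p a) ≫
      (κ'.γ (map_mul p 1 a).symm ≫ famHom φ 1 a rfl) ≫ eqToHom (by rw [one_mul]) := by
  rw [famHom_one_left hφ.1, κ'.γ_left (p 1) (p a) (map_one p) (by rw [one_mul])]
  simp

lemma Compatible.right_unitality {m : A.Z3} {q : A ⟶ DMod.pull p κ'.module}
    {φ : (DMod.pull p κ'.module).Fam2} (hφ : Compatible m q φ) (a : M) :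
    (ρ_ (κ'.obj (p a))).hom = κ'.obj (p a) ◁ eqToHom (by rw [map_one, κ'.obj_one]) ≫
      (κ'.γ (map_mul p a 1).symm ≫ famHom φ a 1 rfl) ≫ eqToHom (by rw [mul_one]) := by
  rw [famHom_one_right hφ.1, κ'.γ_right (p a) (p 1) (map_one p) (by rw [mul_one])]
  simp

end Compatible

/-! ### Monoidal functors from the monoidal groupoid of a 3-cocycle -/

namespace Model

variable {M : Type u} [Monoid M] {A : DMod.{u, v} M} {m : A.Z3} {G' : Type u'} [Groupoid.{v} G']
  [MonoidalCategory G'] [AbelianGroupoid G'] {κ' : Cleavage G'} {p : M →* IsoClass G'}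

variable (m) in
/-- The functor given by a morphism `(p, q)`. -/
@[simps]
noncomputable def functor (q : A ⟶ DMod.pull p κ'.module) : Model m ⥤ G' where
  obj a := κ'.obj (p a.elt)
  map f := eqToHom (by rw [f.eq]) ≫ qHomAut q f.val
  map_id a := by simp [qHomAut_zero]
  map_comp f g := by
    rw [comp_val, qHomAut_add, Category.assoc, ← reassoc_of% (qHomAut_tr q g.eq f.val)]
    simp

lemma functor_map_homMk (q : A ⟶ DMod.pull p κ'.module) {a : Model m} (x : A.at' a.elt) :
    (functor m q).map (homMk (rfl : a.elt = a.elt) x) = qHomAut q x :=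
  Category.id_comp _

lemma functor_map_of_val (q : A ⟶ DMod.pull p κ'.module) {a b : Model m} (f : a ⟶ b)
    (hf : f.val = 0) :
    (functor m q).map f = eqToHom (by rw [functor_obj, functor_obj, f.eq]) := by
  rw [functor_map, hf, qHomAut_zero]
  exact Category.comp_id _

/-- The groupoid is skeletal, so naturality has to be checked only on automorphisms. -/
lemma exists_eq_homMk {a b : Model m} (f : a ⟶ b) :
    ∃ (h : b = a) (x : A.at' a.elt), f = homMk rfl x ≫ eqToHom h.symm := by
  obtain ⟨b⟩ := b
  obtain ⟨e, x⟩ := f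
  dsimp at e x
  subst e
  exact ⟨rfl, x, (Category.comp_id (homMk rfl x)).symm⟩

/-- The monoidal functor given by a morphism `(p, q)` and a compatible 2-cochain. -/
noncomputable def coreMonoidal {q : A ⟶ DMod.pull p κ'.module}
    {φ : (DMod.pull p κ'.module).Fam2} (hφ : Compatible m q φ) : (functor m q).CoreMonoidal where
  εIso := eqToIso (by simp [κ'.obj_one])
  μIso a b := asIso (κ'.γ (map_mul p _ _).symm ≫ famHom φ a.elt b.elt rfl)
  μIso_hom_natural_left {a b} f c := by
    obtain ⟨rfl, x, rfl⟩ := exists_eq_homMk f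
    have e : (functor m q).map (homMk (rfl : b.elt = b.elt) x ▷ c) =
        qHomAut q (A.rstar c.elt rfl x) := functor_map_homMk (m := m) q (a := b ⊗ c) _
    rw [eqToHom_refl, Category.comp_id, functor_map_homMk, e, qHomAut_rstar]
    exact γ_famHom_rst φ b.elt c.elt rfl _ _
  μIso_hom_natural_right {a b} c f := by
    obtain ⟨rfl, x, rfl⟩ := exists_eq_homMk f
    have e : (functor m q).map (c ◁ homMk (rfl : b.elt = b.elt) x) =
        qHomAut q (A.lstar c.elt rfl x) := functor_map_homMk (m := m) q (a := c ⊗ b) _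
    rw [eqToHom_refl, Category.comp_id, functor_map_homMk, e, qHomAut_lstar]
    exact γ_famHom_lst φ c.elt b.elt rfl _ _
  associativity a b c := hφ.associativity a.elt b.elt c.elt
  left_unitality a := by
    rw [functor_map_of_val _ _ (leftUnitor_hom_val a)]
    exact hφ.left_unitality a.elt
  right_unitality a := by
    rw [functor_map_of_val _ _ (rightUnitor_hom_val a)]
    exact hφ.right_unitality a.elt

end Model

open Functor.LaxMonoidal Functor.OplaxMonoidal

/-! ### Monoidal natural transformations in terms of a cleavage -/

section Extend

variable {G : Type u} [Groupoid.{v} G] [MonoidalCategory G] {G' : Type u'} [Groupoid.{v'} G']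
  [MonoidalCategory G'] (κ : Cleavage G) {F F' : G ⥤ G'} [F.Monoidal] [F'.Monoidal]

/-- A monoidal natural isomorphism is determined by its components at the representatives
`X_a`. -/
lemma exists_iso_of_family (w : ∀ a, F.obj (κ.obj a) ⟶ F'.obj (κ.obj a))
    (hw : ∀ a (f : κ.obj a ⟶ κ.obj a), F.map f ≫ w a = w a ≫ F'.map f)
    (w_one : ε F ≫ F.map (eqToHom κ.obj_one.symm) ≫ w 1 = ε F' ≫ F'.map (eqToHom κ.obj_one.symm))
    (w_mul : ∀ a b, (w a ⊗ₘ w b) ≫ μ F' _ _ ≫ F'.map (κ.γ rfl) =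
      μ F _ _ ≫ F.map (κ.γ rfl) ≫ w (a * b)) :
    ∃ e : F ≅ F', NatTrans.IsMonoidal e.hom := by
  -- The component at `X` is forced by naturality along `Γ_X`. Since `w` commutes with
  -- automorphisms, any other `t : X ⟶ X_a` gives the same component.
  let e : ∀ X, F.obj X ⟶ F'.obj X := fun X =>
    F.map (κ.Γ X rfl) ≫ w _ ≫ inv (F'.map (κ.Γ X rfl))
  have key : ∀ {X : G} {a : IsoClass G} (t : X ⟶ κ.obj a), F.map t ≫ w a = e X ≫ F'.map t := by
    intro X a t
    have h : IsoClass.mk X = a := by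
      rw [← κ.mk_obj a]
      exact IsoClass.mk_eq_mk.2 ⟨asIso t⟩
    subst h
    have h := hw _ (inv (κ.Γ X rfl) ≫ t)
    have h' : F.map t = F.map (κ.Γ X rfl) ≫ F.map (inv (κ.Γ X rfl) ≫ t) := by
      rw [← F.map_comp, IsIso.hom_inv_id_assoc]
    rw [h', Category.assoc, h]
    simp [e]
  clear_value e
  have nat : ∀ {X Y : G} (f : X ⟶ Y), F.map f ≫ e Y = e X ≫ F'.map f := by
    intro X Y f
    rw [← cancel_mono (F'.map (κ.Γ Y rfl)), Category.assoc, ← key, Category.assoc,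
      ← F.map_comp_assoc, ← F'.map_comp, key]
  refine ⟨NatIso.ofComponents (fun X => asIso (e X)) (fun f => nat f), ⟨?_, ?_⟩⟩
  · change ε F ≫ e (𝟙_ G) = ε F'
    rw [← cancel_mono (F'.map (eqToHom κ.obj_one.symm)), Category.assoc, ← key, w_one]
  · intro X Y
    change μ F X Y ≫ e (X ⊗ Y) = (e X ⊗ₘ e Y) ≫ μ F' X Y
    -- The cancelled morphism comes from one `X ⊗ Y ⟶ X_{ab}`, so `key` reduces the tensor condition
    -- to the representatives.
    rw [← cancel_mono (F'.map ((κ.Γ X rfl ⊗ₘ κ.Γ Y rfl) ≫ κ.γ rfl)), Category.assoc, ← key,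
      F.map_comp, Category.assoc, ← μ_natural_assoc, ← w_mul,
      tensorHom_comp_tensorHom_assoc, key, key, F'.map_comp, Category.assoc, ← μ_natural_assoc,
      ← tensorHom_comp_tensorHom_assoc]

lemma hom_app_unit_comp_η (e : F ≅ F') [NatTrans.IsMonoidal e.hom] :
    e.hom.app (𝟙_ G) ≫ η F' = η F := by
  rw [← cancel_epi (ε F), ← Category.assoc, NatTrans.IsMonoidal.unit]
  simp

end Extend

/-! ### Monoidal functors and compatible 2-cochains -/

section Comparison

variable {G : Type u} [Groupoid.{v} G] [MonoidalCategory G] [AbelianGroupoid G]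
  {G' : Type u'} [Groupoid.{v} G'] [MonoidalCategory G'] [AbelianGroupoid G']
  {κ : Cleavage G} {κ' : Cleavage G'} {p : IsoClass G →* IsoClass G'}

/-- Isomorphisms `T_a : F X_a ⟶ X'_{p(a)}` which identify the action of the monoidal functor `F`
with `q` and its tensor constraints with `φ`. -/
structure Comparison (F : G ⥤ G') [F.Monoidal] (q : κ.module ⟶ DMod.pull p κ'.module)
    (φ : (DMod.pull p κ'.module).Fam2) (T : ∀ a, F.obj (κ.obj a) ⟶ κ'.obj (p a)) : Prop where
  one : T 1 = F.map (eqToHom κ.obj_one) ≫ η F ≫ eqToHom (by rw [map_one, κ'.obj_one])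
  q_eq : ∀ a (f : κ.obj a ⟶ κ.obj a), F.map f ≫ T a = T a ≫ qHomAut q (toAut f)
  mul : ∀ a b, (T a ⊗ₘ T b) ≫ κ'.γ (map_mul p a b).symm ≫ famHom φ a b rfl =
    μ F _ _ ≫ F.map (κ.γ rfl) ≫ T (a * b)

variable {F F' : G ⥤ G'} [F.Monoidal] [F'.Monoidal]

/-- The cochain measures how far `T` is from respecting the tensor constraints. The isomorphisms
`Γ'` may disagree with the unit constraint of `F`, which would spoil normalization; replacing them
by `T` does not affect `q`. -/
lemma exists_comparison (κ : Cleavage G) (κ' : Cleavage G') (F : G ⥤ G') [F.Monoidal] :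
    ∃ φ T, Comparison F (κ.qHom κ' F) φ T ∧ Compatible κ.cocycle (κ.qHom κ' F) φ := by
  obtain ⟨T, hT⟩ := κ.exists_unit_adapted κ' F
  let φ : (DMod.pull (IsoClass.map F) κ'.module).Fam2 := fun a b =>
    toAut (Cleavage.phi T a b rfl)
  have hφ : ∀ {a b x : IsoClass G} (h : a * b = x),
      famHom φ a b h = Cleavage.phi T a b h := by
    rintro a b _ rfl
    exact famHom_rfl φ a b
  have hq : ∀ {a : IsoClass G} (f : κ.obj a ⟶ κ.obj a),
      qHomAut (κ.qHom κ' F) (toAut f) = inv (T a) ≫ F.map f ≫ T a :=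
    fun f => κ.q_eq_conj κ' F f _
  refine ⟨φ, T, ⟨hT, ?_, ?_⟩, ⟨fun a => ⟨congrArg toAut (Cleavage.phi_one_left T hT a rfl),
    congrArg toAut (Cleavage.phi_one_right T hT a rfl)⟩, ?_⟩⟩
  · intro a f
    rw [hq, IsIso.hom_inv_id_assoc]
  · intro a b
    rw [hφ, Cleavage.T_phi]
  · rw [push_eq_pull_add_iff]
    intro a b c
    rw [hφ, hφ, hφ, hφ]
    refine (Cleavage.phi_cocycle T a b c rfl rfl rfl rfl (mul_assoc a b c).symm
      (map_mul (IsoClass.map F) (a * b) c).symm (by simp [mul_assoc]) (by simp)).trans ?_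
    exact congrArg _ (congrArg _ (hq (κ.lam a b c rfl)).symm)

lemma Comparison.map_eq {q : κ.module ⟶ DMod.pull p κ'.module}
    {φ : (DMod.pull p κ'.module).Fam2} {T : ∀ a, F.obj (κ.obj a) ⟶ κ'.obj (p a)}
    (_ : Comparison F q φ T) : IsoClass.map F = p := by
  ext a
  rw [← κ.mk_map_obj F a, ← κ'.mk_obj (p a)]
  exact IsoClass.mk_eq_mk.2 ⟨asIso (T a)⟩

omit [AbelianGroupoid G] in
-- Moved past `γ'`, the tensor product `s_a ⊗ s_b` becomes `b^* s_a + a_* s_b`, the two outer terms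
-- of `∂s`.
lemma sub_eq_d1_iff (φ φ' : (DMod.pull p κ'.module).Fam2) (s : ∀ a, κ'.obj (p a) ⟶ κ'.obj (p a)) :
    φ - φ' = (DMod.pull p κ'.module).d1 (fun a => toAut (s a)) ↔
    ∀ a b, (s a ⊗ₘ s b) ≫ κ'.γ (map_mul p a b).symm ≫ famHom φ' a b rfl =
      κ'.γ (map_mul p a b).symm ≫ famHom φ a b rfl ≫ s (a * b) := by
  simp only [funext_iff]
  refine forall_congr' fun a => forall_congr' fun b => ?_
  have e : (s a ⊗ₘ s b) ≫ κ'.γ (map_mul p a b).symm ≫ famHom φ' a b rfl =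
      κ'.γ (map_mul p a b).symm ≫ κ'.rst (p b) (map_mul p a b).symm (s a) ≫
        κ'.lst (p a) (map_mul p a b).symm (s b) ≫ famHom φ' a b rfl := by
    rw [reassoc_of% (κ'.γ_rst (p b) (map_mul p a b).symm (s a)),
      reassoc_of% (κ'.γ_lst (p a) (map_mul p a b).symm (s b)), MonoidalCategory.tensorHom_def,
      Category.assoc]
  rw [e, cancel_epi, famHom_rfl, famHom_rfl]
  have key : ∀ {x y l t r l' r' : autGrp (κ'.obj (p (a * b)))}, l = l' → r = r' →
      (x - y = l - t + r ↔ r' + (l' + y) = x + t) := by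
    rintro x y l t r _ _ rfl rfl
    rw [sub_eq_iff_eq_add]
    constructor
    · rintro rfl
      abel
    · intro h
      rw [eq_sub_of_add_eq h.symm]
      abel
  refine key ?_ ?_
  · refine (DMod.pull_lstar p κ'.module _ (by simp) _).trans ?_
    exact κ'.lstar_toAut _ _ _
  · refine (DMod.pull_rstar p κ'.module _ (by simp) _).trans ?_
    exact κ'.rstar_toAut _ _ _

/-- Through `T` and `T'`, a transformation becomes a family of automorphisms of the objects
`X'_{p(a)}`, that is, a 1-cochain. Naturality on each `Aut(X_a)` is automatic because both functors
induce `q` and the groups are abelian. The unit condition is normalization, and the tensor condition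
is `φ - φ' = ∂δ`. -/
lemma Comparison.isomorphic_iff {q : κ.module ⟶ DMod.pull p κ'.module}
    {φ φ' : (DMod.pull p κ'.module).Fam2} {T : ∀ a, F.obj (κ.obj a) ⟶ κ'.obj (p a)}
    {T' : ∀ a, F'.obj (κ.obj a) ⟶ κ'.obj (p a)}
    (h : Comparison F q φ T) (h' : Comparison F' q φ' T') :
    (∃ e : F ≅ F', NatTrans.IsMonoidal e.hom) ↔ φ - φ' ∈ (DMod.pull p κ'.module).B2 := by
  constructor
  · rintro ⟨e, _⟩
    let s : ∀ a, κ'.obj (p a) ⟶ κ'.obj (p a) := fun a => inv (T a) ≫ e.hom.app _ ≫ T' a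
    have hs : ∀ a, e.hom.app _ ≫ T' a = T a ≫ s a := fun a => by simp [s]
    refine ⟨fun a => toAut (s a), ?_, ((sub_eq_d1_iff φ φ' s).2 ?_).symm⟩
    · have hs1 : s 1 = 𝟙 _ := by
        rw [← cancel_epi (T 1), ← hs, h'.one, Category.comp_id, h.one, ← e.hom.naturality_assoc,
          reassoc_of% (hom_app_unit_comp_η e)]
      exact congrArg toAut hs1
    · intro a b
      rw [← cancel_epi (T a ⊗ₘ T b), tensorHom_comp_tensorHom_assoc, ← hs, ← hs,
        ← tensorHom_comp_tensorHom_assoc, h'.mul, ← NatTrans.IsMonoidal.tensor_assoc,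
        ← e.hom.naturality_assoc, hs, reassoc_of% (h.mul a b)]
  · rintro ⟨δ, hδ, hd⟩
    let s : ∀ a, κ'.obj (p a) ⟶ κ'.obj (p a) := fun a => ofAut (X := κ'.obj (p a)) (δ a)
    have hs := (sub_eq_d1_iff φ φ' s).1 hd.symm
    have hs1 : s 1 = 𝟙 _ := toAut_inj hδ
    let w : ∀ a, F.obj (κ.obj a) ⟶ F'.obj (κ.obj a) := fun a => T a ≫ s a ≫ inv (T' a)
    have hw : ∀ a, w a ≫ T' a = T a ≫ s a := fun a => by simp [w]
    refine exists_iso_of_family κ w ?_ ?_ ?_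
    · intro a f
      rw [← cancel_mono (T' a), Category.assoc, hw, Category.assoc, h'.q_eq, reassoc_of% (hw a),
        reassoc_of% (h.q_eq a f), AbelianGroupoid.comm (s a)]
    · rw [← cancel_mono (T' 1), Category.assoc, Category.assoc, hw, hs1, h.one, Category.assoc,
        h'.one, Category.comp_id, ← F.map_comp_assoc, Category.assoc,
        ← F'.map_comp_assoc]
      simp
    · intro a b
      rw [← cancel_mono (T' (a * b)), Category.assoc, Category.assoc, ← h'.mul,
        tensorHom_comp_tensorHom_assoc, hw, hw, Category.assoc, Category.assoc, hw,
        ← reassoc_of% (h.mul a b), ← hs, tensorHom_comp_tensorHom_assoc]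

end Comparison

open Functor.LaxMonoidal Functor.OplaxMonoidal

/-! ### Realization of compatible cochains by monoidal functors. -/

section Realization

variable {G : Type u} [Groupoid.{v} G] [MonoidalCategory G] [AbelianGroupoid G]
  {G' : Type u'} [Groupoid.{v} G'] [MonoidalCategory G'] [AbelianGroupoid G']
  {κ : Cleavage G} {κ' : Cleavage G'} {p : IsoClass G →* IsoClass G'}

/-- The identity of the module, as a morphism over the identity of the monoid. -/
noncomputable def idHom (κ : Cleavage G) :
    κ.module ⟶ DMod.pull (MonoidHom.id (IsoClass G)) κ.module :=
  𝟙 κ.module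

/-- This supplies the monoidal functor from the groupoid of `λ(G)` to `G` itself. -/
lemma compatible_zero (κ : Cleavage G) : Compatible κ.cocycle (idHom κ) 0 := by
  refine ⟨AddSubgroup.zero_mem _, ?_⟩
  rw [map_zero, add_zero]
  funext a b c
  exact (DMod.tr_rfl _ _ _).symm

namespace Model

/-- The groupoid of `λ(G)` is a skeleton of `G`: it has one object for each class `a`, with
automorphism group `Aut(X_a)`. -/
lemma isEquivalence_functor_idHom (κ : Cleavage G) :
    (functor κ.cocycle (idHom κ)).IsEquivalence := by
  have h1 : (functor κ.cocycle (idHom κ)).Faithful := ⟨fun {a b f g} h =>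
    hom_ext ((cancel_epi (eqToHom _)).1 h)⟩
  have h2 : (functor κ.cocycle (idHom κ)).Full := ⟨by
    intro a b f
    let f' : κ.obj a.elt ⟶ κ.obj b.elt := f
    have e : a.elt = b.elt := by
      rw [← κ.mk_obj a.elt, ← κ.mk_obj b.elt]
      exact IsoClass.mk_eq_mk.2 ⟨asIso f'⟩
    obtain ⟨b⟩ := b
    dsimp at e
    subst e
    exact ⟨homMk rfl (toAut f'), Category.id_comp _⟩⟩
  have h3 : (functor κ.cocycle (idHom κ)).EssSurj := ⟨by
    intro X
    exact ⟨⟨IsoClass.mk X⟩, ⟨(asIso (κ.Γ X rfl)).symm⟩⟩⟩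
  exact {}

/-- A monoidal functor is compared with `(p, q)` and `φ` by a monoidal isomorphism of its
restriction to the groupoid of the cocycle. -/
lemma comparison_of_iso (F : G ⥤ G') [F.Monoidal] (q : κ.module ⟶ DMod.pull p κ'.module)
    {φ : (DMod.pull p κ'.module).Fam2} (hφ : Compatible κ.cocycle q φ)
    (W : letI := (coreMonoidal (compatible_zero κ)).toMonoidal
      functor κ.cocycle (idHom κ) ⋙ F ≅ functor κ.cocycle q)
    (hW : letI := (coreMonoidal (compatible_zero κ)).toMonoidal
      letI := (coreMonoidal hφ).toMonoidal
      NatTrans.IsMonoidal W.hom) :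
    Comparison F q φ (fun a => W.hom.app ⟨a⟩) := by
  let := (coreMonoidal (compatible_zero κ)).toMonoidal
  let := (coreMonoidal hφ).toMonoidal
  constructor
  · let T : F.obj (κ.obj 1) ⟶ κ'.obj (p 1) := W.hom.app ⟨1⟩
    have h : (ε F ≫ F.map (eqToHom κ.obj_one.symm)) ≫ T =
      eqToHom (show 𝟙_ G' = κ'.obj (p 1) by rw [map_one, κ'.obj_one]) := hW.unit
    change T = _
    rw [← cancel_epi (ε F ≫ F.map (eqToHom κ.obj_one.symm)), h, Category.assoc,
      ← F.map_comp_assoc]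
    simp
  · intro a f
    have h := W.hom.naturality (homMk (a := ⟨a⟩) (b := ⟨a⟩) rfl (toAut f))
    have h1 : (functor κ.cocycle (idHom κ)).map (homMk (a := ⟨a⟩) (b := ⟨a⟩) rfl (toAut f)) = f :=
      functor_map_homMk (m := κ.cocycle) (idHom κ) (a := ⟨a⟩) (toAut f)
    have h2 := functor_map_homMk (m := κ.cocycle) q (a := ⟨a⟩) (toAut f)
    exact (congrArg (fun k => F.map k ≫ W.hom.app ⟨a⟩) h1.symm).trans
      (h.trans (congrArg (W.hom.app ⟨a⟩ ≫ ·) h2))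
  · intro a b
    have h := hW.tensor ⟨a⟩ ⟨b⟩
    -- The cochain is zero, so the constraint is `γ` without a twist.
    have h1 : μ (functor κ.cocycle (idHom κ)) ⟨a⟩ ⟨b⟩ = κ.γ rfl := by
      refine Eq.trans ?_ (Category.comp_id (κ.γ rfl))
      exact congrArg (κ.γ rfl ≫ ·) (famHom_rfl (p := MonoidHom.id (IsoClass G)) 0 a b)
    refine h.symm.trans ?_
    refine Eq.trans ?_ (Category.assoc _ _ _)
    refine congrArg (· ≫ W.hom.app (⟨a⟩ ⊗ ⟨b⟩)) ?_
    exact congrArg (fun k => μ F _ _ ≫ F.map k) h1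

/-- The functor is an inverse of the skeleton equivalence `E` followed by the functor `R` built from
`φ`; the unit of `E` identifies its restriction along `E` with `R`. -/
lemma exists_functor_iso {q : κ.module ⟶ DMod.pull p κ'.module}
    {φ : (DMod.pull p κ'.module).Fam2} (hφ : Compatible κ.cocycle q φ) :
    ∃ (F : G ⥤ G') (_ : F.Monoidal) (T : _), Comparison F q φ T := by
  let E := functor κ.cocycle (idHom κ)
  let R := functor κ.cocycle q
  have : E.IsEquivalence := isEquivalence_functor_idHom κ
  let e := E.asEquivalence
  let : E.Monoidal := (coreMonoidal (compatible_zero κ)).toMonoidal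
  let : R.Monoidal := (coreMonoidal hφ).toMonoidal
  let : e.functor.Monoidal := (coreMonoidal (compatible_zero κ)).toMonoidal
  let := e.inverseMonoidal
  have : e.IsMonoidal := isMonoidal_inverseMonoidal e
  have : NatTrans.IsMonoidal e.unitIso.hom := inferInstanceAs (NatTrans.IsMonoidal e.unit)
  have : NatTrans.IsMonoidal e.unitIso.inv := inferInstance
  let W : E ⋙ e.inverse ⋙ R ≅ R := (Functor.associator E e.inverse R).symm ≪≫
    Functor.isoWhiskerRight e.unitIso.symm R ≪≫ R.leftUnitor
  refine ⟨e.inverse ⋙ R, inferInstance, _, comparison_of_iso (e.inverse ⋙ R) q hφ W ?_⟩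
  exact inferInstanceAs (NatTrans.IsMonoidal ((Functor.associator e.functor e.inverse R).inv ≫
    Functor.whiskerRight e.unitIso.inv R ≫ R.leftUnitor.hom))

end Model

end Realization

/-! ### Counting isomorphism classes of functors by `H²`. -/

lemma DMod.nonempty_quotient_equiv_H2 {M : Type u} [Monoid M] (B : DMod.{u, v} M) {ι : Type w}
    (r : Setoid ι) (φ : ι → B.Fam2) (φ₀ : B.Fam2) (hφ : ∀ i, φ i - φ₀ ∈ B.Z2)
    (hr : ∀ i j, r i j ↔ φ i - φ j ∈ B.B2) (hs : ∀ ψ ∈ B.Z2, ∃ i, φ₀ + ψ - φ i ∈ B.B2) :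
    Nonempty (_root_.Quotient r ≃ B.H2) := by
  -- The class of the difference from the base point `φ₀`; this choice makes the bijection
  -- non-natural.
  let c : ι → B.H2 := fun i =>
    QuotientAddGroup.mk (s := B.B2.addSubgroupOf B.Z2) ⟨φ i - φ₀, hφ i⟩
  have hc : ∀ i j, c i = c j ↔ r i j := by
    intro i j
    refine (QuotientAddGroup.eq (s := B.B2.addSubgroupOf B.Z2)).trans ?_
    rw [hr, AddSubgroup.mem_addSubgroupOf, ← neg_mem_iff]
    have : -(-(φ i - φ₀) + (φ j - φ₀)) = φ i - φ j := by abel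
    exact iff_of_eq (congrArg (· ∈ B.B2) this)
  refine ⟨Equiv.ofBijective (Quotient.lift c fun i j h => (hc i j).2 h) ⟨?_, ?_⟩⟩
  · rintro ⟨i⟩ ⟨j⟩ h
    exact Quotient.sound ((hc i j).1 h)
  · intro x
    obtain ⟨⟨ψ, hψ⟩, rfl⟩ := QuotientAddGroup.mk_surjective (s := B.B2.addSubgroupOf B.Z2) x
    obtain ⟨i, hi⟩ := hs ψ hψ
    refine ⟨Quotient.mk _ i, ?_⟩
    refine (QuotientAddGroup.eq (s := B.B2.addSubgroupOf B.Z2)).2 ?_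
    rw [AddSubgroup.mem_addSubgroupOf]
    have : -(φ i - φ₀) + ψ = φ₀ + ψ - φ i := by abel
    exact (congrArg (· ∈ B.B2) this).mpr hi

/-- Two compatible cochains have the same coboundary, so they differ by a 2-cocycle; conversely,
adding a 2-cocycle preserves compatibility. -/
lemma nonempty_quotient_equiv_H2_of_comparison {G G' : MonAbGpd.{u, v}} {κ : Cleavage G.carrier}
    {κ' : Cleavage G'.carrier} {p : IsoClass G.carrier →* IsoClass G'.carrier}
    (q : κ.module ⟶ DMod.pull p κ'.module) {P : (G ⟶ G') → Prop}
    (h₀ : ∃ φ, Compatible κ.cocycle q φ)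
    (h₁ : ∀ F, P F → ∃ φ T, Comparison F.functor q φ T ∧ Compatible κ.cocycle q φ)
    (h₂ : ∀ φ, Compatible κ.cocycle q φ → ∃ F T, P F ∧ Comparison F.functor q φ T) :
    Nonempty (_root_.Quotient (MonAbGpd.isoSetoid P) ≃ (DMod.pull p κ'.module).H2) := by
  obtain ⟨φ₀, hφ₀⟩ := h₀
  choose φ T hT hφ using fun F : {F : G ⟶ G' // P F} => h₁ F.1 F.2
  refine DMod.nonempty_quotient_equiv_H2 _ _ φ φ₀ ?_
    (fun F F' => Comparison.isomorphic_iff (hT F) (hT F')) ?_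
  · intro F
    refine ⟨AddSubgroup.sub_mem _ (hφ F).1 hφ₀.1, AddMonoidHom.mem_ker.2 ?_⟩
    rw [map_sub, sub_eq_zero]
    exact add_left_cancel ((hφ F).2.symm.trans hφ₀.2)
  · rintro ψ ⟨hψ, hψ'⟩
    obtain ⟨F, T', hF, hT'⟩ := h₂ (φ₀ + ψ) ⟨AddSubgroup.add_mem _ hφ₀.1 hψ, by
      rw [hφ₀.2, map_add, AddMonoidHom.mem_ker.1 hψ', add_zero]⟩
    -- The cochain chosen for `F` need not be `φ₀ + ψ`. Both are compared with the same `F`, so its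
    -- identity shows that they differ by a coboundary.
    exact ⟨⟨F, hF⟩, (Comparison.isomorphic_iff hT' (hT ⟨F, hF⟩)).1 ⟨Iso.refl _,
      inferInstanceAs (NatTrans.IsMonoidal (𝟙 _))⟩⟩

/-! ### Lifting arrows along the classifying functor. -/

variable (κ : ∀ G : MonAbGpd.{u, v}, Cleavage G.carrier)

/-- With `f` a variable, the equality can be eliminated, which avoids transporting a comparison
along an equality of monoid homomorphisms. -/
lemma exists_comparison_of_map_eq {G G' : MonAbGpd.{u, v}} {F : G ⟶ G'}
    {f : (classifyingFunctor κ).obj G ⟶ (classifyingFunctor κ).obj G'}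
    (h : (classifyingFunctor κ).map F = f) :
    ∃ φ T, Comparison (κ := κ G) (κ' := κ G') (p := f.p) F.functor f.q φ T ∧
      Compatible (κ' := κ G') (p := f.p) (κ G).cocycle f.q φ := by
  subst h
  exact exists_comparison (κ G) (κ G') F.functor

lemma map_eq_of_comparison {G G' : MonAbGpd.{u, v}} {F : G ⟶ G'}
    {f : (classifyingFunctor κ).obj G ⟶ (classifyingFunctor κ).obj G'} {φ T}
    (h : Comparison (κ := κ G) (κ' := κ G') (p := f.p) F.functor f.q φ T) :
    (classifyingFunctor κ).map F = f := by
  refine H3Mnd.hom_ext h.map_eq ?_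
  intro (a : IsoClass G.carrier) x
  refine (κ G').tr_eq_of_sim (f := (κ G).qMap (κ G') F.functor (ofAut x))
    (g := qHomAut (κ' := κ G') (p := f.p) f.q x) _ ?_
  exact ((κ G).qMap_sim _ _ _).trans ⟨T a, h.q_eq a (ofAut x)⟩

/-- The condition on an arrow of `H3Mnd` equates the classes of two explicit cocycles; a cochain
witnessing this is a compatible one. -/
lemma exists_compatible {G G' : MonAbGpd.{u, v}}
    (f : (classifyingFunctor κ).obj G ⟶ (classifyingFunctor κ).obj G') :
    ∃ φ, Compatible (κ' := κ G') (p := f.p) (κ G).cocycle f.q φ :=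
  (DMod.H3.cls_eq_iff _ _).1 f.comm

lemma exists_comparison_of_compatible {G G' : MonAbGpd.{u, v}}
    (f : (classifyingFunctor κ).obj G ⟶ (classifyingFunctor κ).obj G') {φ}
    (h : Compatible (κ' := κ G') (p := f.p) (κ G).cocycle f.q φ) :
    ∃ (F : G ⟶ G') (T : _),
      Comparison (κ := κ G) (κ' := κ G') (p := f.p) F.functor f.q φ T := by
  obtain ⟨F, hF, T, hT⟩ := Model.exists_functor_iso h
  exact ⟨⟨F⟩, T, hT⟩

theorem exists_isEquivalence_map_eq {G G' : MonAbGpd.{u, v}}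
    (e : (classifyingFunctor κ).obj G ≅ (classifyingFunctor κ).obj G') :
    ∃ F : G ⟶ G', MonAbGpd.IsEquivalence F ∧ (classifyingFunctor κ).map F = e.hom := by
  obtain ⟨φ, hφ⟩ := exists_compatible κ e.hom
  obtain ⟨F, T, hT⟩ := exists_comparison_of_compatible κ e.hom hφ
  have h := map_eq_of_comparison κ hT
  exact ⟨F, (isEquivalence_iff_isIso κ F).2 (h ▸ inferInstance), h⟩

theorem nonempty_quotient_equiv_H2 {G G' : MonAbGpd.{u, v}}
    (f : (classifyingFunctor κ).obj G ⟶ (classifyingFunctor κ).obj G') :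
    Nonempty (
      _root_.Quotient (MonAbGpd.isoSetoid
        (fun F : G ⟶ G' => (classifyingFunctor κ).map F = f)) ≃
      (DMod.pull f.p ((classifyingFunctor κ).obj G').A).H2) := by
  refine nonempty_quotient_equiv_H2_of_comparison (κ := κ G) (κ' := κ G') (p := f.p) f.q
    (exists_compatible κ f) (fun F hF => exists_comparison_of_map_eq κ hF) (fun φ hφ => ?_)
  obtain ⟨F, T, hT⟩ := exists_comparison_of_compatible κ f hφ
  exact ⟨F, T, map_eq_of_comparison κ hT, hT⟩

end Leech

theorem mainTheorem2
    (κ : ∀ G : Leech.MonAbGpd.{u, v}, Leech.Cleavage G.carrier) :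
    (∀ S : Leech.H3Mnd.{u, v}, ∃ G : Leech.MonAbGpd.{u, v},
      Nonempty ((Leech.classifyingFunctor κ).obj G ≅ S)) ∧
    (∀ (G G' : Leech.MonAbGpd.{u, v}) (F : G ⟶ G'),
      Leech.MonAbGpd.IsEquivalence F ↔ IsIso ((Leech.classifyingFunctor κ).map F)) ∧
    (∀ (G G' : Leech.MonAbGpd.{u, v})
      (e : (Leech.classifyingFunctor κ).obj G ≅ (Leech.classifyingFunctor κ).obj G'),
      ∃ F : G ⟶ G', Leech.MonAbGpd.IsEquivalence F ∧
        (Leech.classifyingFunctor κ).map F = e.hom) ∧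
    (∀ (G G' : Leech.MonAbGpd.{u, v})
      (f : (Leech.classifyingFunctor κ).obj G ⟶ (Leech.classifyingFunctor κ).obj G'),
      Nonempty (
        _root_.Quotient (Leech.MonAbGpd.isoSetoid
          (fun F : G ⟶ G' => (Leech.classifyingFunctor κ).map F = f)) ≃
        (Leech.DMod.pull f.p ((Leech.classifyingFunctor κ).obj G').A).H2)) :=
  ⟨Leech.exists_classifyingFunctor_iso κ, fun _ _ F => Leech.isEquivalence_iff_isIso κ F,
    fun _ _ e => Leech.exists_isEquivalence_map_eq κ e,
    fun _ _ f => Leech.nonempty_quotient_equiv_H2 κ f⟩
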